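/- For a Boolean function $f:\{0,1\}^n\to\{0,1\}$ let $gap(f)=\sum_{x\in\{0,1\}^n}(-1)^{f(x)}$. Algorithms are multi-tape Turing machines with two possible choices in each step; read as nondeterministic machines they accept if some computation path accepts, read as probabilistic machines the choices are independent fair coin tosses, and in both cases the running time is the largest number of steps over all computation paths. Assume the following conjecture. For every constant $a>0$ there is a polynomial $p$ such that, whenever $A$ is a nondeterministic algorithm that, given the description of any Boolean circuit $f$ (over NOT, AND, OR) with $n$ inputs and at most $p(n)$ gates, runs in time $T(n)$, accepts if $gap(f)\neq0$ and rejects if $gap(f)=0$, then $T(n)>2^{(1-a)n}$ for infinitely many $n$. Then for every constant $a>0$ there is a family $(C_h)_{h\in\mathbb N}$ of quantum circuits, where $C_h$ consists of classical gates (NOT, CNOT, TOFFOLI) and exactly $h$ Hadamard gates and has a number of qubits and of gates polynomial in $h$, whose output probabilities cannot be classically sampled in time $2^{(1-a)(\frac h2-\frac12)}$ within a multiplicative error $\epsilon<1$, in the following sense. Let $p_{acc}(C_h)=|\langle 0^N|C_h|0^N\rangle|^2$, where $N$ is the number of qubits of $C_h$, be the probability of the outcome $0^N$. For every classical probabilistic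 algorithm $A$ there are infinitely many $h$ such that for no $\epsilon<1$ it is true that $A$, given the description of $C_h$, runs in time at most $2^{(1-a)(\frac h2-\frac12)}$ and accepts with a probability $q_{acc}$ satisfying $|p_{acc}(C_h)-q_{acc}|\le\epsilon\, p_{acc}(C_h)$. -/

import Mathlib

namespace FineGrained

/-! ### Boolean circuits -/

/-- A gate of a Boolean circuit. The operands are numbers of wires. -/
inductive BGate where
  | not (i : ℕ)
  | and (i j : ℕ)
  | or (i j : ℕ)

/-- All operands of the gate are wires with number less than `m`. -/
def BGate.UsesBelow (m : ℕ) : BGate → Prop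
  | .not i => i < m
  | .and i j => i < m ∧ j < m
  | .or i j => i < m ∧ j < m

/-- Value of a gate, given the list of the values of all earlier wires. -/
def BGate.eval (w : List Bool) : BGate → Bool
  | .not i => !(w.getD i false)
  | .and i j => w.getD i false && w.getD j false
  | .or i j => w.getD i false || w.getD j false

/-- A Boolean circuit with `n` inputs, fan-in at most two and unbounded fan-out, written as a
straight-line program: wires `0, …, n - 1` carry the input bits, the gate at position `k` of the
list drives wire `n + k` and reads wires with smaller numbers only. The last wire is the output,
so there has to be at least one wire. -/
structure BoolCircuit (n : ℕ) where
  gates : List BGate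
  uses_below : ∀ (k : ℕ) (hk : k < gates.length), (gates[k]).UsesBelow (n + k)
  wires_pos : 0 < n + gates.length

namespace BoolCircuit

variable {n : ℕ}

/-- The number of gates. -/
def size (f : BoolCircuit n) : ℕ := f.gates.length

/-- The values of all wires on input `x`. -/
def wires (f : BoolCircuit n) (x : Fin n → Bool) : List Bool :=
  f.gates.foldl (fun w g => w ++ [g.eval w]) (List.ofFn x)

/-- The Boolean function computed by the circuit: the value of the last wire. -/
def eval (f : BoolCircuit n) (x : Fin n → Bool) : Bool :=
  (f.wires x).getLastD false

/-- `gap(f) = ∑ₓ (-1)^{f(x)}`. -/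
def gap (f : BoolCircuit n) : ℤ :=
  ∑ x : Fin n → Bool, if f.eval x then -1 else 1

end BoolCircuit

/-! ### Quantum circuits over classical reversible gates and Hadamard gates -/

/-- Gates on `N` qubits: NOT, CNOT, TOFFOLI (the classical gates) and the Hadamard gate. -/
inductive QGate (N : ℕ) where
  | X (t : Fin N)
  | CNOT (c t : Fin N) (distinct : c ≠ t)
  | TOFFOLI (a b t : Fin N) (distinct : a ≠ b ∧ a ≠ t ∧ b ≠ t)
  | H (t : Fin N)

namespace QGate

variable {N : ℕ}

/-- Is the gate a Hadamard gate? -/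
def isH : QGate N → Bool
  | .H _ => true
  | _ => false

/-- Permutation matrix of a map on computational basis states: it sends `|y⟩` to `|g y⟩`. -/
def basisMatrix (g : (Fin N → Bool) → (Fin N → Bool)) :
    Matrix (Fin N → Bool) (Fin N → Bool) ℂ :=
  Matrix.of fun x y => if x = g y then 1 else 0

/-- The Hadamard gate on qubit `t` (the identity on the other qubits). -/
noncomputable def hadamardMatrix (t : Fin N) : Matrix (Fin N → Bool) (Fin N → Bool) ℂ :=
  Matrix.of fun x y =>
    if ∀ i, i ≠ t → x i = y i then
      (if x t && y t then -1 else 1) / (Real.sqrt 2 : ℂ)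
    else 0

/-- The unitary matrix of a gate, in the computational basis of `N` qubits. -/
noncomputable def matrix : QGate N → Matrix (Fin N → Bool) (Fin N → Bool) ℂ
  | .X t => basisMatrix fun y => Function.update y t (!(y t))
  | .CNOT c t _ => basisMatrix fun y => Function.update y t (xor (y t) (y c))
  | .TOFFOLI a b t _ => basisMatrix fun y => Function.update y t (xor (y t) (y a && y b))
  | .H t => hadamardMatrix t

end QGate

/-- A quantum circuit over classical gates and Hadamard gates. The head of the list of gates is
applied first. -/
structure QCircuit where
  numQubits : ℕ
  gates : List (QGate numQubits)

namespace QCircuit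

/-- The number of Hadamard gates. -/
def numH (C : QCircuit) : ℕ := C.gates.countP QGate.isH

/-- The unitary matrix of the circuit. -/
noncomputable def unitary (C : QCircuit) :
    Matrix (Fin C.numQubits → Bool) (Fin C.numQubits → Bool) ℂ :=
  C.gates.foldl (fun U g => g.matrix * U) 1

/-- The acceptance probability `|⟨0ᴺ| C |0ᴺ⟩|²`: the probability of the outcome `0ᴺ` when all
qubits of `C |0ᴺ⟩` are measured in the computational basis. -/
noncomputable def acceptProb (C : QCircuit) : ℝ :=
  ‖C.unitary (fun _ => false) (fun _ => false)‖ ^ 2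

end QCircuit

/-! ### Descriptions of circuits as bit strings

Numbers are written in unary. Both descriptions are prefix-free, hence injective, and have length
polynomial in the numbers of wires and gates. -/

/-- `k` is written as `k` ones followed by a zero. -/
def encodeNat (k : ℕ) : List Bool := List.replicate k true ++ [false]

def BGate.encode : BGate → List Bool
  | .not i => [false, false] ++ encodeNat i
  | .and i j => [false, true] ++ encodeNat i ++ encodeNat j
  | .or i j => [true, false] ++ encodeNat i ++ encodeNat j

def QGate.encode {N : ℕ} : QGate N → List Bool
  | .X t => [false, false] ++ encodeNat t
  | .CNOT c t _ => [false, true] ++ encodeNat c ++ encodeNat t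
  | .TOFFOLI a b t _ => [true, false] ++ encodeNat a ++ encodeNat b ++ encodeNat t
  | .H t => [true, true] ++ encodeNat t

/-- The number of inputs, then every gate preceded by a one, then a zero. -/
def BoolCircuit.encode {n : ℕ} (f : BoolCircuit n) : List Bool :=
  encodeNat n ++ f.gates.flatMap (fun g => true :: g.encode) ++ [false]

/-- The number of qubits, then every gate preceded by a one, then a zero. -/
def QCircuit.encode (C : QCircuit) : List Bool :=
  encodeNat C.numQubits ++ C.gates.flatMap (fun g => true :: g.encode) ++ [false]

/-! ### Multi-tape Turing machines with two choices per step

A machine has two transition functions `δ false` and `δ true`. Read with existential choices it is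
a nondeterministic machine; read with fair coin tosses it is a probabilistic machine. -/

/-- Tape symbols: blank (`none`), an input bit, or one of `g` further work symbols. -/
abbrev Symbol (g : ℕ) : Type := Option (Bool ⊕ Fin g)

/-- A Turing machine with `numTapes + 1` two-way infinite tapes; the input is on tape `0`. In a
non-halting state it reads the symbols under all heads and, depending on the choice bit, changes
its state and on each tape writes a symbol and then moves the head by at most one cell. -/
structure Machine where
  numTapes : ℕ
  numSymbols : ℕ
  numStates : ℕ
  start : Fin numStates
  /-- `some true`: halt and accept; `some false`: halt and reject; `none`: continue. -/
  verdict : Fin numStates → Option Bool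
  δ : Bool → Fin numStates → (Fin (numTapes + 1) → Symbol numSymbols) →
    Fin numStates × (Fin (numTapes + 1) → Symbol numSymbols × Option Turing.Dir)

namespace Machine

variable (M : Machine)

/-- A configuration: the state and the tapes, each with its head position. -/
structure Cfg where
  state : Fin M.numStates
  tape : Fin (M.numTapes + 1) → Turing.Tape (Symbol M.numSymbols)

/-- The initial configuration: the head of tape `0` is on the first symbol of the input, and the
other tapes are blank. -/
def init (x : List Bool) : M.Cfg where
  state := M.start
  tape := fun k => Turing.Tape.mk₁ (if k = 0 then x.map (fun b => some (Sum.inl b)) else [])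

/-- Write a symbol, then possibly move the head. -/
def act {g : ℕ} (T : Turing.Tape (Symbol g)) (w : Symbol g × Option Turing.Dir) :
    Turing.Tape (Symbol g) :=
  match w.2 with
  | none => T.write w.1
  | some d => (T.write w.1).move d

/-- One step with choice bit `b`. Halted configurations do not change. -/
def step (c : M.Cfg) (b : Bool) : M.Cfg :=
  match M.verdict c.state with
  | some _ => c
  | none =>
    let r := M.δ b c.state (fun k => (c.tape k).head)
    { state := r.1, tape := fun k => act (c.tape k) (r.2 k) }

/-- The verdict on input `x` after as many steps as there are choice bits. -/
def result (x : List Bool) (choices : List Bool) : Option Bool :=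
  M.verdict (choices.foldl M.step (M.init x)).state

/-- On input `x`, every computation path halts within `t` steps. -/
def HaltsWithin (x : List Bool) (t : ℕ) : Prop :=
  ∀ ω : Fin t → Bool, M.result x (List.ofFn ω) ≠ none

/-- Nondeterministic acceptance: some computation path accepts. -/
def NondetAccepts (x : List Bool) : Prop :=
  ∃ choices : List Bool, M.result x choices = some true

/-- The probability that the machine has accepted after `t` steps when all choices are independent
fair coin tosses. -/
noncomputable def coinAcceptProb (x : List Bool) (t : ℕ) : ℝ :=
  (Fintype.card {ω : Fin t → Bool // M.result x (List.ofFn ω) = some true} : ℝ) / 2 ^ t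

/-- Given the description of the quantum circuit `C`, the probabilistic machine `M` runs in time at
most `τ` and accepts with a probability `q_acc` such that `|p_acc - q_acc| ≤ ε p_acc`, where `p_acc`
is the acceptance probability of `C`. -/
def Samples (C : QCircuit) (ε τ : ℝ) : Prop :=
  ∃ t : ℕ, (t : ℝ) ≤ τ ∧ M.HaltsWithin C.encode t ∧
    |C.acceptProb - M.coinAcceptProb C.encode t| ≤ ε * C.acceptProb

/-- The machine, as a nondeterministic `T(n)`-time machine, accepts (the description of) a Boolean
circuit `f` with `n` inputs and at most `p(n)` gates if `gap(f) ≠ 0`, and rejects it if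
`gap(f) = 0`. -/
def DecidesGap (p : Polynomial ℕ) (T : ℕ → ℕ) : Prop :=
  ∀ (n : ℕ) (f : BoolCircuit n), f.size ≤ p.eval n →
    M.HaltsWithin f.encode (T n) ∧ (M.NondetAccepts f.encode ↔ f.gap ≠ 0)

end Machine

/-- The conjecture: for every `a > 0`, any nondeterministic `T(n)`-time algorithm that decides
whether `gap(f) ≠ 0` for polynomial-size Boolean circuits `f` with `n` inputs satisfies
`T(n) > 2^((1-a)n)` for infinitely many `n`. -/
def GapConjecture : Prop :=
  ∀ a : ℝ, 0 < a → ∃ p : Polynomial ℕ, ∀ (M : Machine) (T : ℕ → ℕ), M.DecidesGap p T →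
    ∃ᶠ n : ℕ in Filter.atTop, (2 : ℝ) ^ ((1 - a) * (n : ℝ)) < (T n : ℝ)

end FineGrained

/-! The proof reduces deciding `gap(f) ≠ 0` to sampling, and then diagonalizes over machines.

A Boolean circuit `f` becomes a palindromic quantum circuit: Hadamards on the inputs and a
reversible evaluation of `f` (matrix `U`), a phase flip on the output qubit (matrix `D`), and the
same gates in reverse order. Every gate matrix is symmetric, so the second half is `Uᵀ` and the
amplitude at `0ᴺ` is `∑ y, U y 0 ^ 2 * D y y = gap(f) / 2ⁿ` (`unitary_gapCircuit`). The number of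
Hadamards is `2n + 2`, plus `2d` for padding by cancelling pairs, whatever the size of `f`.

A sampler with multiplicative error below one accepts with positive probability exactly when the
circuit does. Read as a nondeterministic machine it therefore decides `gap(f) ≠ 0` from the
description of the quantum circuit (`Samples.nondetAccepts_iff`). The description is computed from
that of `f` by an explicit Turing machine in polynomial time (`exists_machine`).

If one machine sampled all circuits of suitable polynomial size with at least `d` Hadamards, the gap
problem would be solved in time `poly(n) + 2^((1-a)(n+d+1/2))`. For large `n` this is below the
conjectured bound with parameter `min a 1 / 2`: the constant `d` and the polynomial vanish in the
slack (`frequently_not_samples`). So each machine fails on circuits with arbitrarily large `h`.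
There are countably many machines, and a single family is obtained by giving each of them infinitely
many values of `h`. -/

namespace FineGrained
open Matrix

/-! ### The circuit of a Boolean circuit -/

/-- A gate whose qubits are given by natural numbers. -/
inductive RGate where
  | x (t : ℕ)
  | cnot (c t : ℕ)
  | toff (a b t : ℕ)
  | had (t : ℕ)

namespace RGate

def isHad : RGate → Bool
  | had _ => true
  | _ => false

def encode : RGate → List Bool
  | x t => [false, false] ++ encodeNat t
  | cnot c t => [false, true] ++ encodeNat c ++ encodeNat t
  | toff a b t => [true, false] ++ encodeNat a ++ encodeNat b ++ encodeNat t
  | had t => [true, true] ++ encodeNat t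

/-- The operands are distinct qubits with numbers below `N`. -/
def Valid (N : ℕ) : RGate → Prop
  | x t => t < N
  | cnot c t => c < N ∧ t < N ∧ c ≠ t
  | toff a b t => a < N ∧ b < N ∧ t < N ∧ a ≠ b ∧ a ≠ t ∧ b ≠ t
  | had t => t < N

/-- The gate on `N` qubits, which is arbitrary if the gate is not valid. -/
def toQ (N : ℕ) [NeZero N] : RGate → QGate N
  | x t => .X (Fin.ofNat N t)
  | cnot c t =>
    if h : Fin.ofNat N c ≠ Fin.ofNat N t then .CNOT _ _ h else .X 0
  | toff a b t =>
    if h : Fin.ofNat N a ≠ Fin.ofNat N b ∧ Fin.ofNat N a ≠ Fin.ofNat N t ∧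
      Fin.ofNat N b ≠ Fin.ofNat N t then .TOFFOLI _ _ _ h else .X 0
  | had t => .H (Fin.ofNat N t)

variable {N : ℕ} [NeZero N]

theorem ofNat_ne {a b : ℕ} (ha : a < N) (hb : b < N) (h : a ≠ b) :
    Fin.ofNat N a ≠ Fin.ofNat N b := by
  intro e
  have := congrArg Fin.val e
  simp only [Fin.ofNat, Nat.mod_eq_of_lt ha, Nat.mod_eq_of_lt hb] at this
  exact h this

theorem val_ofNat {a : ℕ} (ha : a < N) : (Fin.ofNat N a : ℕ) = a := Nat.mod_eq_of_lt ha

theorem toQ_cnot {c t : ℕ} (h : (cnot c t).Valid N) :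
    toQ N (cnot c t) = .CNOT (Fin.ofNat N c) (Fin.ofNat N t) (ofNat_ne h.1 h.2.1 h.2.2) :=
  dif_pos _

theorem toQ_toff {a b t : ℕ} (h : (toff a b t).Valid N) :
    toQ N (toff a b t) = .TOFFOLI (Fin.ofNat N a) (Fin.ofNat N b) (Fin.ofNat N t)
      ⟨ofNat_ne h.1 h.2.1 h.2.2.2.1, ofNat_ne h.1 h.2.2.1 h.2.2.2.2.1,
        ofNat_ne h.2.1 h.2.2.1 h.2.2.2.2.2⟩ :=
  dif_pos _

theorem encode_toQ {g : RGate} (h : g.Valid N) : (toQ N g).encode = g.encode := by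
  cases g with
  | x t => simp only [toQ, QGate.encode, encode, val_ofNat (show t < N from h)]
  | cnot c t =>
    rw [toQ_cnot h]
    simp only [QGate.encode, encode, val_ofNat h.1, val_ofNat h.2.1]
  | toff a b t =>
    rw [toQ_toff h]
    simp only [QGate.encode, encode, val_ofNat h.1, val_ofNat h.2.1, val_ofNat h.2.2.1]
  | had t => simp only [toQ, QGate.encode, encode, val_ofNat (show t < N from h)]

theorem isH_toQ (g : RGate) : (toQ N g).isH = g.isHad := by
  cases g <;> simp only [toQ, isHad, QGate.isH] <;> split_ifs <;> rfl

end RGate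

/-- The block that computes the value of a Boolean gate into the qubit of wire `w`. -/
def gateBlock (w : ℕ) : BGate → List RGate
  | .not i => [.cnot (3 * i + 3) (3 * w + 3), .x (3 * w + 3)]
  | .and i j => [.cnot (3 * i + 3) (3 * w + 4), .cnot (3 * j + 3) (3 * w + 5),
      .toff (3 * w + 4) (3 * w + 5) (3 * w + 3)]
  | .or i j => [.cnot (3 * i + 3) (3 * w + 4), .x (3 * w + 4), .cnot (3 * j + 3) (3 * w + 5),
      .x (3 * w + 5), .toff (3 * w + 4) (3 * w + 5) (3 * w + 3), .x (3 * w + 3)]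

def gateBlocks : ℕ → List BGate → List RGate
  | _, [] => []
  | w, g :: gs => gateBlock w g ++ gateBlocks (w + 1) gs

/-- Hadamard gates on the qubits of the wires `w, …, w + n - 1`. -/
def hadBlock (w n : ℕ) : List RGate := (List.range' w n).map fun v => .had (3 * v + 3)

/-- The phase flip on qubit `t`, followed by `d` cancelling pairs of Hadamard gates. -/
def phaseBlock (t d : ℕ) : List RGate :=
  [.had t, .x t, .had t] ++ List.replicate (2 * d) (.had 0)

namespace BoolCircuit

variable {n : ℕ} (f : BoolCircuit n)

/-- The ancillas are left dirty. They need no separate uncomputation, since `gapGates` ends with the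
same list reversed. -/
def prepare : List RGate := hadBlock 0 n ++ gateBlocks n f.gates

def gapGates (d : ℕ) : List RGate :=
  f.prepare ++ phaseBlock (3 * (n + f.size)) d ++ f.prepare.reverse

/-- A circuit with amplitude `gap(f) / 2ⁿ`. -/
def gapCircuit (d : ℕ) : QCircuit where
  numQubits := 3 * (n + f.size) + 3
  gates := (f.gapGates d).map (RGate.toQ _)

end BoolCircuit

/-! ### Matrices of lists of gates -/

namespace QGate

variable {N : ℕ}

/-- The unitary matrix of a list of gates. -/
noncomputable def listMatrix (L : List (QGate N)) : Matrix (Fin N → Bool) (Fin N → Bool) ℂ :=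
  L.foldl (fun U g => g.matrix * U) 1

theorem foldl_matrix (L : List (QGate N)) (U : Matrix (Fin N → Bool) (Fin N → Bool) ℂ) :
    L.foldl (fun U g => g.matrix * U) U = listMatrix L * U := by
  induction L generalizing U with
  | nil => simp [listMatrix]
  | cons g L ih =>
    rw [listMatrix, List.foldl_cons, List.foldl_cons, ih, ih (g.matrix * 1)]
    simp [mul_assoc]

@[simp] theorem listMatrix_nil : listMatrix ([] : List (QGate N)) = 1 := rfl

theorem listMatrix_append (L L' : List (QGate N)) :
    listMatrix (L ++ L') = listMatrix L' * listMatrix L := by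
  rw [listMatrix, List.foldl_append, foldl_matrix, ← listMatrix]

theorem listMatrix_cons (g : QGate N) (L : List (QGate N)) :
    listMatrix (g :: L) = listMatrix L * g.matrix := by
  rw [listMatrix, List.foldl_cons, foldl_matrix, mul_one]

/-- The action of a classical gate on basis states. -/
def fn : QGate N → (Fin N → Bool) → (Fin N → Bool)
  | .X t => fun y => Function.update y t (!(y t))
  | .CNOT c t _ => fun y => Function.update y t (xor (y t) (y c))
  | .TOFFOLI a b t _ => fun y => Function.update y t (xor (y t) (y a && y b))
  | .H _ => id

theorem matrix_eq_basisMatrix {g : QGate N} (h : g.isH = false) : g.matrix = basisMatrix g.fn := by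
  cases g <;> first | rfl | cases h

theorem fn_involutive (g : QGate N) : Function.Involutive g.fn := by
  intro y
  cases g with
  | X t => simp [fn]
  | CNOT c t h => simp [fn, Function.update_of_ne h]
  | TOFFOLI a b t h => simp [fn, Function.update_of_ne h.2.1, Function.update_of_ne h.2.2]
  | H t => rfl

theorem basisMatrix_transpose {g : (Fin N → Bool) → (Fin N → Bool)} (h : Function.Involutive g) :
    (basisMatrix g)ᵀ = basisMatrix g := by
  ext x y
  have : y = g x ↔ x = g y := ⟨fun e => by rw [e, h], fun e => by rw [e, h]⟩
  simp only [basisMatrix, Matrix.transpose_apply, Matrix.of_apply, this]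

theorem matrix_transpose (g : QGate N) : g.matrixᵀ = g.matrix := by
  cases hg : g.isH with
  | false => rw [matrix_eq_basisMatrix hg, basisMatrix_transpose g.fn_involutive]
  | true =>
    cases g with
    | H t =>
      ext x y
      simp only [matrix, hadamardMatrix, Matrix.transpose_apply, Matrix.of_apply,
        Bool.and_comm (y t), eq_comm]
    | _ => cases hg

/-- Reversing a product of symmetric matrices transposes it. Hence no inverse of a circuit has to be
formed. -/
theorem listMatrix_reverse (L : List (QGate N)) : listMatrix L.reverse = (listMatrix L)ᵀ := by
  induction L with
  | nil => simp
  | cons g L ih =>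
    rw [List.reverse_cons, listMatrix_append, listMatrix_cons, listMatrix_cons, ih,
      Matrix.transpose_mul, matrix_transpose, listMatrix_nil, one_mul]

/-- The action of a list of classical gates on basis states. -/
def listFn (L : List (QGate N)) (y : Fin N → Bool) : Fin N → Bool := L.foldl (fun y g => g.fn y) y

theorem listFn_bijective (L : List (QGate N)) : Function.Bijective (listFn L) := by
  induction L with
  | nil => exact Function.bijective_id
  | cons g L ih => exact ih.comp g.fn_involutive.bijective

theorem basisMatrix_mul (g : (Fin N → Bool) → (Fin N → Bool)) (hg : Function.Injective g)
    (V : Matrix (Fin N → Bool) (Fin N → Bool) ℂ) (z w : Fin N → Bool) :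
    (basisMatrix g * V) (g z) w = V z w := by
  simp [Matrix.mul_apply, basisMatrix, hg.eq_iff]

/-- Classical gates permute the rows. Evaluating at the image `listFn L z` rather than at `z` avoids
inverting the permutation. -/
theorem listMatrix_mul_listFn (L : List (QGate N)) (hL : ∀ g ∈ L, g.isH = false)
    (V : Matrix (Fin N → Bool) (Fin N → Bool) ℂ) (z w : Fin N → Bool) :
    (listMatrix L * V) (listFn L z) w = V z w := by
  induction L generalizing V z with
  | nil => simp [listFn]
  | cons g L ih =>
    rw [listMatrix_cons, mul_assoc, listFn, List.foldl_cons, ← listFn,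
      ih (fun g hg => hL g (List.mem_cons_of_mem _ hg)),
      matrix_eq_basisMatrix (hL g List.mem_cons_self), basisMatrix_mul _ g.fn_involutive.injective]

/-- Row `x` of the matrix is supported on the two states that agree with `x` off `t`. All
computations with Hadamard gates go through this two-term formula. -/
theorem hadamardMatrix_mul (t : Fin N) (V : Matrix (Fin N → Bool) (Fin N → Bool) ℂ)
    (x w : Fin N → Bool) :
    (hadamardMatrix t * V) x w =
      (V (Function.update x t false) w + (if x t then -1 else 1) * V (Function.update x t true) w)
        / (Real.sqrt 2 : ℂ) := by
  have hne : Function.update x t false ≠ Function.update x t true := by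
    intro e
    simpa using congrFun e t
  rw [Matrix.mul_apply, ← Finset.sum_subset (Finset.subset_univ
    {Function.update x t false, Function.update x t true})]
  · rw [Finset.sum_pair hne]
    have h (b : Bool) : ∀ i, i ≠ t → x i = Function.update x t b i :=
      fun i hi => (Function.update_of_ne hi _ _).symm
    simp only [hadamardMatrix, Matrix.of_apply, if_pos (h _), Function.update_self, Bool.and_true,
      Bool.and_false, Bool.false_eq_true, if_false]
    ring
  · intro y _ hy
    rw [hadamardMatrix, Matrix.of_apply, if_neg, zero_mul]
    intro h
    apply hy
    have : y = Function.update x t (y t) := by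
      funext i
      by_cases hi : i = t
      · subst hi; simp
      · rw [Function.update_of_ne hi, h i hi]
    rw [this]
    cases y t <;> simp

theorem sqrt_two_sq : (Real.sqrt 2 : ℂ) * (Real.sqrt 2 : ℂ) = 2 := by
  rw [← Complex.ofReal_mul, Real.mul_self_sqrt (by norm_num)]; norm_num

theorem sqrt_two_ne : (Real.sqrt 2 : ℂ) ≠ 0 := by
  intro h
  simpa [h] using sqrt_two_sq

theorem hadamardMatrix_mul_mul_self (t : Fin N) (V : Matrix (Fin N → Bool) (Fin N → Bool) ℂ) :
    hadamardMatrix t * (hadamardMatrix t * V) = V := by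
  ext x w
  obtain ⟨ψ, hψ⟩ : ∃ ψ : (Fin N → Bool) → ℂ, ∀ y, V y w = ψ y := ⟨fun y => V y w, fun _ => rfl⟩
  rw [hadamardMatrix_mul, hadamardMatrix_mul, hadamardMatrix_mul]
  simp only [hψ, Function.update_self, Function.update_idem]
  have h2 := sqrt_two_ne
  cases hx : x t with
  | false =>
    rw [show Function.update x t false = x by rw [← hx, Function.update_eq_self]]
    simp only [Bool.false_eq_true, if_false, if_true]
    field_simp
    linear_combination -ψ x * sqrt_two_sq
  | true =>
    rw [show Function.update x t true = x by rw [← hx, Function.update_eq_self]]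
    simp only [Bool.false_eq_true, if_false, if_true]
    field_simp
    linear_combination -ψ x * sqrt_two_sq

theorem matrix_X_mul (t : Fin N) (V : Matrix (Fin N → Bool) (Fin N → Bool) ℂ)
    (y w : Fin N → Bool) :
    ((QGate.X t).matrix * V) y w = V (Function.update y t (!(y t))) w := by
  have h := basisMatrix_mul (QGate.X t).fn (QGate.X t).fn_involutive.injective V
    ((QGate.X t).fn y) w
  rw [(QGate.X t).fn_involutive y] at h
  exact h

theorem phase_mul (t : Fin N) (V : Matrix (Fin N → Bool) (Fin N → Bool) ℂ)
    (x w : Fin N → Bool) :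
    (hadamardMatrix t * ((QGate.X t).matrix * (hadamardMatrix t * V))) x w =
      (if x t then (-1 : ℂ) else 1) * V x w := by
  obtain ⟨ψ, hψ⟩ : ∃ ψ : (Fin N → Bool) → ℂ, ∀ y, V y w = ψ y := ⟨fun y => V y w, fun _ => rfl⟩
  rw [hadamardMatrix_mul, matrix_X_mul, matrix_X_mul, hadamardMatrix_mul, hadamardMatrix_mul]
  simp only [hψ, Function.update_self, Function.update_idem]
  have h2 := sqrt_two_ne
  cases hx : x t with
  | false =>
    simp only [Bool.false_eq_true, if_false, if_true, Bool.not_false, Bool.not_true]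
    rw [show Function.update x t false = x by rw [← hx, Function.update_eq_self]]
    field_simp
    linear_combination -ψ x * sqrt_two_sq
  | true =>
    simp only [Bool.false_eq_true, if_false, if_true, Bool.not_false, Bool.not_true]
    rw [show Function.update x t true = x by rw [← hx, Function.update_eq_self]]
    field_simp
    linear_combination ψ x * sqrt_two_sq

/-- The identity `HXH = Z`. -/
theorem listMatrix_phase (t : Fin N) :
    listMatrix [.H t, .X t, .H t] = Matrix.diagonal fun y => if y t then (-1 : ℂ) else 1 := by
  ext x w
  have h := phase_mul t 1 x w
  simp only [listMatrix_cons, listMatrix_nil, one_mul]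
  rw [mul_one, ← mul_assoc] at h
  refine h.trans ?_
  rw [Matrix.diagonal_apply, Matrix.one_apply]
  split_ifs <;> simp

theorem listMatrix_replicate_H (t : Fin N) (d : ℕ) :
    listMatrix (List.replicate (2 * d) (.H t)) = 1 := by
  induction d with
  | zero => simp
  | succ d ih =>
    rw [show 2 * (d + 1) = 2 * d + 1 + 1 by ring, List.replicate_succ, List.replicate_succ,
      listMatrix_cons, listMatrix_cons, ih, one_mul]
    simpa using! hadamardMatrix_mul_mul_self t 1

end QGate

/-! ### The superposition created by Hadamard gates -/

namespace QGate

variable {N : ℕ}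

theorem listMatrix_hadamards (ts : List (Fin N)) (hts : ts.Nodup) (z : Fin N → Bool)
    [Decidable (∀ i, z i = true → i ∈ ts)] :
    listMatrix (ts.map .H) z (fun _ => false) =
      if ∀ i, z i = true → i ∈ ts then (1 / (Real.sqrt 2 : ℂ)) ^ ts.length else 0 := by
  classical
  induction ts using List.reverseRecOn generalizing z with
  | nil =>
    have : (∀ i, z i = true → i ∈ ([] : List (Fin N))) ↔ z = fun _ => false := by
      simp [funext_iff]
    simp only [List.map_nil, listMatrix_nil, List.length_nil, pow_zero, Matrix.one_apply, this]
  | append_singleton ts t ih =>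
    have hnd : ts.Nodup := hts.of_append_left
    have ht : t ∉ ts := by
      rw [List.nodup_append] at hts
      exact fun h => hts.2.2 t h t (by simp) rfl
    rw [List.map_append, listMatrix_append, List.map_singleton, listMatrix_cons, listMatrix_nil,
      one_mul]
    -- As `t ∉ ts`, the earlier gates leave qubit `t` at zero: the term with `t` set vanishes, and
    -- each new gate contributes one factor `1/√2`.
    rw [show (QGate.H t).matrix = hadamardMatrix t from rfl, hadamardMatrix_mul, ih hnd, ih hnd, if_neg (c := ∀ i, Function.update z t true i = true → i ∈ ts)
        (fun h => ht (h t (by simp))), mul_zero,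
      add_zero]
    have : (∀ i, Function.update z t false i = true → i ∈ ts) ↔
        ∀ i, z i = true → i ∈ ts ++ [t] := by
      refine forall_congr' fun i => ?_
      by_cases hi : i = t
      · subst hi; simp
      · simp [hi]
    simp only [this, List.length_append, List.length_singleton, pow_succ]
    split_ifs <;> ring

end QGate

/-! ### Reversible evaluation of a Boolean circuit, on bits indexed by `ℕ` -/

namespace RGate

/-- The action of a classical gate on infinitely many bits. -/
def app : RGate → (ℕ → Bool) → (ℕ → Bool)
  | x t => fun y => Function.update y t (!(y t))
  | cnot c t => fun y => Function.update y t (xor (y t) (y c))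
  | toff a b t => fun y => Function.update y t (xor (y t) (y a && y b))
  | had _ => id

variable {N : ℕ} [NeZero N]

/-- The bits with numbers below `N` are those of `s`. -/
def Agrees (s : Fin N → Bool) (σ : ℕ → Bool) : Prop := ∀ i < N, s (Fin.ofNat N i) = σ i

theorem Agrees.update {s : Fin N → Bool} {σ : ℕ → Bool} (h : Agrees s σ) {t : ℕ} (ht : t < N)
    {b c : Bool} (hb : b = c) :
    Agrees (Function.update s (Fin.ofNat N t) b) (Function.update σ t c) := by
  intro i hi
  by_cases e : i = t
  · subst e; simpa using hb
  · rw [Function.update_of_ne (ofNat_ne hi ht e), Function.update_of_ne e, h i hi]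

/-- Validity keeps the operands below `N`, where reduction modulo `N` is injective. Classical
simulation can thus be done on `ℕ → Bool`, free of the number of qubits. -/
theorem Agrees.fn {s : Fin N → Bool} {σ : ℕ → Bool} (h : Agrees s σ) {g : RGate}
    (hg : g.Valid N) : Agrees ((toQ N g).fn s) (g.app σ) := by
  cases g with
  | x t => exact h.update hg (by rw [h t hg])
  | cnot c t =>
    rw [toQ_cnot hg]
    exact h.update hg.2.1 (by rw [h t hg.2.1, h c hg.1])
  | toff a b t =>
    rw [toQ_toff hg]
    exact h.update hg.2.2.1 (by rw [h t hg.2.2.1, h a hg.1, h b hg.2.1])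
  | had t => exact h

theorem Agrees.listFn {s : Fin N → Bool} {σ : ℕ → Bool} (h : Agrees s σ) {L : List RGate}
    (hL : ∀ g ∈ L, g.Valid N) :
    Agrees (QGate.listFn (L.map (toQ N)) s) (L.foldl (fun σ g => g.app σ) σ) := by
  induction L generalizing s σ with
  | nil => exact h
  | cons g L ih =>
    exact ih (h.fn (hL g List.mem_cons_self)) fun g hg => hL g (List.mem_cons_of_mem _ hg)

end RGate

/-- The bits hold the values of the wires in `l`, and all later bits are zero. -/
def HoldsWires (σ : ℕ → Bool) (l : List Bool) : Prop :=
  (∀ v < l.length, σ (3 * v + 3) = l.getD v false) ∧ ∀ i, 3 * l.length + 3 ≤ i → σ i = false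

theorem getD_append_lt (l : List Bool) (b : Bool) {v : ℕ} (h : v < l.length) :
    (l ++ [b]).getD v false = l.getD v false := by
  simp [List.getD, List.getElem?_append_left h]

/-- Only the three bits of the new wire may change. The values of its two ancillas afterwards are
irrelevant, since the invariant never reads them again. -/
theorem holdsWires_append {σ τ : ℕ → Bool} {l : List Bool} {b : Bool} (h : HoldsWires σ l)
    (hτ : ∀ i, i < 3 * l.length + 3 ∨ 3 * l.length + 6 ≤ i → τ i = σ i)
    (hb : τ (3 * l.length + 3) = b) : HoldsWires τ (l ++ [b]) := by
  constructor
  · intro v hv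
    rw [List.length_append, List.length_singleton] at hv
    by_cases e : v = l.length
    · subst e; rw [hb]; simp
    · have hv : v < l.length := by omega
      rw [getD_append_lt l b hv, hτ _ (by omega), h.1 v hv]
  · intro i hi
    rw [List.length_append, List.length_singleton] at hi
    rw [hτ _ (by omega), h.2 i (by omega)]

/-- AND and OR first copy their operands to fresh ancillas: the controls of a TOFFOLI gate must be
distinct, but both operands may be the same wire. OR is computed by De Morgan. The invariant
supplies that the three new bits start at zero. -/
theorem HoldsWires.gateBlock {σ : ℕ → Bool} {l : List Bool} (h : HoldsWires σ l) {g : BGate}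
    (hg : g.UsesBelow l.length) :
    HoldsWires ((gateBlock l.length g).foldl (fun σ g => g.app σ) σ) (l ++ [g.eval l]) := by
  have h3 := h.2 (3 * l.length + 3) (by omega)
  have h4 := h.2 (3 * l.length + 4) (by omega)
  have h5 := h.2 (3 * l.length + 5) (by omega)
  have ne (a b : ℕ) (hab : a ≠ b) (ρ : ℕ → Bool) (c : Bool) : Function.update ρ b c a = ρ a :=
    Function.update_of_ne hab _ _
  refine holdsWires_append h (fun i hi => ?_) ?_
  · have e3 : i ≠ 3 * l.length + 3 := by omega
    have e4 : i ≠ 3 * l.length + 4 := by omega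
    have e5 : i ≠ 3 * l.length + 5 := by omega
    cases g <;>
      simp only [FineGrained.gateBlock, List.foldl_cons, List.foldl_nil, RGate.app, ne _ _ e3,
        ne _ _ e4, ne _ _ e5]
  · cases g with
    | not i =>
      have hi := h.1 i hg
      have e : 3 * i + 3 ≠ 3 * l.length + 3 := by have : i < l.length := hg; omega
      simp [FineGrained.gateBlock, RGate.app, BGate.eval, hi, h3]
    | and i j =>
      have hi := h.1 i hg.1
      have hj := h.1 j hg.2
      -- Simplified form of `3 * j + 3 ≠ 3 * l.length + 4`: operand `j` is read after the first
      -- ancilla has been written.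
      have e : 3 * j ≠ 3 * l.length + 1 := by omega
      simp [FineGrained.gateBlock, RGate.app, BGate.eval, hi, hj, h3, h4,
        h5, e]
    | or i j =>
      have hi := h.1 i hg.1
      have hj := h.1 j hg.2
      have e : 3 * j ≠ 3 * l.length + 1 := by omega
      simp [FineGrained.gateBlock, RGate.app, BGate.eval, hi, hj, h3, h4,
        h5, e]

theorem HoldsWires.gateBlocks {gs : List BGate} {σ : ℕ → Bool} {l : List Bool}
    (h : HoldsWires σ l)
    (hgs : ∀ (k : ℕ) (hk : k < gs.length), (gs[k]).UsesBelow (l.length + k)) :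
    HoldsWires ((gateBlocks l.length gs).foldl (fun σ g => g.app σ) σ)
      (gs.foldl (fun w g => w ++ [g.eval w]) l) := by
  induction gs generalizing σ l with
  | nil => exact h
  | cons g gs ih =>
    rw [FineGrained.gateBlocks, List.foldl_append, List.foldl_cons]
    have h1 := h.gateBlock (g := g) (hgs 0 (by simp))
    have e : l.length + 1 = (l ++ [g.eval l]).length := by simp
    rw [e]
    refine ih h1 fun k hk => ?_
    have := hgs (k + 1) (by simpa using hk)
    rw [← e, add_assoc, add_comm 1]
    simpa using this

theorem gateBlock_valid {N w : ℕ} {g : BGate} (hg : g.UsesBelow w) (hN : 3 * w + 6 ≤ N) :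
    ∀ r ∈ gateBlock w g, r.Valid N ∧ r.isHad = false := by
  cases g <;> simp only [BGate.UsesBelow] at hg <;>
    simp [gateBlock, RGate.Valid, RGate.isHad] <;> omega

theorem gateBlocks_valid {N : ℕ} {gs : List BGate} {w : ℕ}
    (hgs : ∀ (k : ℕ) (hk : k < gs.length), (gs[k]).UsesBelow (w + k))
    (hN : 3 * (w + gs.length) + 3 ≤ N) :
    ∀ r ∈ gateBlocks w gs, r.Valid N ∧ r.isHad = false := by
  induction gs generalizing w with
  | nil => simp [gateBlocks]
  | cons g gs ih =>
    intro r hr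
    rw [List.length_cons] at hN
    rcases List.mem_append.1 hr with hr | hr
    · exact gateBlock_valid (hgs 0 (by simp)) (by omega) r hr
    · refine ih (fun k hk => ?_) (by omega) r hr
      have := hgs (k + 1) (by simpa using hk)
      rw [add_assoc, add_comm 1]
      simpa using this

theorem length_gateBlock_le (w : ℕ) (g : BGate) : (gateBlock w g).length ≤ 6 := by
  cases g <;> simp [gateBlock]

theorem length_gateBlocks_le (w : ℕ) (gs : List BGate) :
    (gateBlocks w gs).length ≤ 6 * gs.length := by
  induction gs generalizing w with
  | nil => simp [gateBlocks]
  | cons g gs ih =>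
    have := ih (w + 1)
    have := length_gateBlock_le w g
    simp only [gateBlocks, List.length_append, List.length_cons]
    omega

/-! ### Size, Hadamard count and amplitude of the gap circuit -/

namespace BoolCircuit

variable {n : ℕ} (f : BoolCircuit n)

theorem length_wires (x : Fin n → Bool) : (f.wires x).length = n + f.size := by
  have (gs : List BGate) (l : List Bool) :
      (gs.foldl (fun w g => w ++ [g.eval w]) l).length = l.length + gs.length := by
    induction gs generalizing l with
    | nil => rfl
    | cons g gs ih => rw [List.foldl_cons, ih]; simp; omega
  rw [wires, this, List.length_ofFn, size]

theorem prepare_valid : ∀ r ∈ f.prepare, r.Valid (3 * (n + f.size) + 3) := by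
  intro r hr
  rcases List.mem_append.1 hr with hr | hr
  · obtain ⟨v, hv, rfl⟩ := List.mem_map.1 hr
    rw [List.mem_range'_1] at hv
    simp only [RGate.Valid]
    omega
  · exact (gateBlocks_valid f.uses_below (le_refl _) r hr).1

theorem gapGates_valid (d : ℕ) : ∀ r ∈ f.gapGates d, r.Valid (3 * (n + f.size) + 3) := by
  intro r hr
  simp only [gapGates, phaseBlock, List.mem_append, List.mem_reverse, List.mem_replicate] at hr
  rcases hr with (hr | hr | hr) | hr
  · exact f.prepare_valid r hr
  · simp only [List.mem_cons, List.not_mem_nil, or_false] at hr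
    rcases hr with rfl | rfl | rfl <;> simp [RGate.Valid]
  · rw [hr.2]; simp [RGate.Valid]
  · exact f.prepare_valid r hr

theorem numQubits_gapCircuit (d : ℕ) : (f.gapCircuit d).numQubits = 3 * (n + f.size) + 3 := rfl

theorem length_gapCircuit_le (d : ℕ) :
    (f.gapCircuit d).gates.length ≤ 2 * n + 12 * f.size + 3 + 2 * d := by
  have := length_gateBlocks_le n f.gates
  simp only [gapCircuit, gapGates, phaseBlock, prepare, hadBlock, List.length_map,
    List.length_append, List.length_reverse, List.length_range', List.length_replicate,
    List.length_cons, List.length_nil, size] at this ⊢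
  omega

theorem countP_hadBlock (w n : ℕ) : (hadBlock w n).countP RGate.isHad = n := by
  rw [List.countP_eq_length.2]
  · simp [hadBlock]
  · intro r hr
    obtain ⟨v, -, rfl⟩ := List.mem_map.1 hr
    rfl

/-- Each half contributes `n`, the phase flip two. That the size of `f` does not enter is what ties
time bounds in `h / 2` to time bounds in `n`. -/
theorem numH_gapCircuit (d : ℕ) : (f.gapCircuit d).numH = 2 * n + 2 + 2 * d := by
  have h : (gateBlocks n f.gates).countP RGate.isHad = 0 := by
    rw [List.countP_eq_zero]
    intro r hr
    simp [(gateBlocks_valid f.uses_below (le_refl _) r hr).2]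
  have e : (QGate.isH ∘ RGate.toQ (3 * (n + f.size) + 3)) = RGate.isHad :=
    funext RGate.isH_toQ
  rw [QCircuit.numH, gapCircuit, List.countP_map]
  change List.countP (QGate.isH ∘ RGate.toQ (3 * (n + f.size) + 3)) _ = _
  rw [e]
  simp only [gapGates, phaseBlock, prepare, List.countP_append, List.countP_reverse,
    countP_hadBlock, h, List.countP_replicate, List.countP_cons, List.countP_nil, RGate.isHad]
  simp
  omega

/-- The number of the qubit of wire `w`. -/
def wireQubit (N : ℕ) [NeZero N] (w : ℕ) : Fin N := Fin.ofNat N (3 * w + 3)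

/-- The basis state in which the input wires hold `x`. -/
def inputState (N : ℕ) [NeZero N] (x : Fin n → Bool) (i : Fin N) : Bool :=
  if h : (i : ℕ) % 3 = 0 ∧ 3 ≤ (i : ℕ) ∧ (i : ℕ) / 3 - 1 < n then x ⟨(i : ℕ) / 3 - 1, h.2.2⟩
  else false

theorem inputState_wireQubit {N : ℕ} [NeZero N] (hN : 3 * n + 3 ≤ N) (x : Fin n → Bool)
    (w : Fin n) : inputState N x (wireQubit N w) = x w := by
  have hw := w.2
  have e : ((wireQubit N w : Fin N) : ℕ) = 3 * w + 3 := RGate.val_ofNat (by omega)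
  have e' : (3 * (w : ℕ) + 3) / 3 - 1 = w := by omega
  rw [inputState, dif_pos (by rw [e]; omega)]
  congr 1
  apply Fin.ext
  simp only [e, e']

theorem listFn_inputState (x : Fin n → Bool) :
    QGate.listFn ((gateBlocks n f.gates).map (RGate.toQ (3 * (n + f.size) + 3)))
      (inputState _ x) (Fin.ofNat _ (3 * (n + f.size))) = f.eval x := by
  have hN : 3 * n + 3 ≤ 3 * (n + f.size) + 3 := by omega
  let σ : ℕ → Bool := fun i =>
    if h : i % 3 = 0 ∧ 3 ≤ i ∧ i / 3 - 1 < n then x ⟨i / 3 - 1, h.2.2⟩ else false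
  have hσ : RGate.Agrees (inputState (3 * (n + f.size) + 3) x) σ := by
    intro i hi
    simp only [inputState, σ, RGate.val_ofNat hi]
  have h0 : HoldsWires σ (List.ofFn x) := by
    constructor
    · intro v hv
      rw [List.length_ofFn] at hv
      have e' : (3 * v + 3) / 3 - 1 = v := by omega
      have : σ (3 * v + 3) = x ⟨v, hv⟩ := by
        simp only [σ]
        rw [dif_pos (by omega)]
        simp only [e']
      rw [this]
      simp [List.getD, hv]
    · intro i hi
      rw [List.length_ofFn] at hi
      exact dif_neg (by omega)
  have h1 := h0.gateBlocks (gs := f.gates) (by simpa using f.uses_below)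
  rw [List.length_ofFn] at h1
  have h2 := hσ.listFn (L := gateBlocks n f.gates)
    fun r hr => (gateBlocks_valid f.uses_below (le_refl _) r hr).1
  have hpos : 0 < n + f.size := f.wires_pos
  have hl := f.length_wires x
  -- The output is the last wire `n + f.size - 1`, whose qubit is `3 * (n + f.size)`.
  rw [h2 _ (by omega), show 3 * (n + f.size) = 3 * (n + f.size - 1) + 3 by omega,
    h1.1 _ (by rw [← wires, hl]; omega), ← wires, eval]
  have hne : f.wires x ≠ [] := by
    intro e; rw [e] at hl; simp at hl; omega
  rw [List.getLastD_eq_getLast?, List.getLast?_eq_getElem?, hl]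
  rfl

/-- The column at `0ᴺ` of the matrix of `prepare` equals `2^(-n/2)` on the images of the `2ⁿ` input
states and zero elsewhere. It enters squared, weighted by the phase `(-1)^f(x)`. -/
theorem unitary_gapCircuit (d : ℕ) :
    (f.gapCircuit d).unitary (fun _ => false) (fun _ => false) = (f.gap : ℂ) / 2 ^ n := by
  classical
  set N := 3 * (n + f.size) + 3 with hNdef
  set R := (gateBlocks n f.gates).map (RGate.toQ N) with hR
  set ts := (List.range' 0 n).map (wireQubit N) with hts
  set t : Fin N := Fin.ofNat N (3 * (n + f.size)) with ht
  have hpre : f.prepare.map (RGate.toQ N) = ts.map QGate.H ++ R := by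
    rw [prepare, List.map_append, hadBlock, hts, List.map_map, List.map_map]
    exact congrArg (· ++ R) (List.map_congr_left fun v _ => rfl)
  have hgates : (f.gapGates d).map (RGate.toQ N) = (ts.map QGate.H ++ R) ++
      ([.H t, .X t, .H t] ++ List.replicate (2 * d) (.H (Fin.ofNat N 0))) ++
      (ts.map QGate.H ++ R).reverse := by
    rw [gapGates, phaseBlock, List.map_append, List.map_append, List.map_reverse, hpre,
      List.map_append, List.map_replicate]
    rfl
  change QGate.listMatrix ((f.gapGates d).map (RGate.toQ N)) (fun _ => false) (fun _ => false) = _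
  rw [hgates, QGate.listMatrix_append, QGate.listMatrix_append, QGate.listMatrix_reverse,
    QGate.listMatrix_append [_, _, _], QGate.listMatrix_replicate_H, one_mul,
    QGate.listMatrix_phase, Matrix.mul_apply]
  simp only [Matrix.diagonal_mul, Matrix.transpose_apply]
  have hRcl : ∀ g ∈ R, g.isH = false := by
    intro g hg
    obtain ⟨r, hr, rfl⟩ := List.mem_map.1 hg
    rw [RGate.isH_toQ]
    exact (gateBlocks_valid f.uses_below (le_refl _) r hr).2
  have hwq {v : ℕ} (hv : v < n) : ((wireQubit N v : Fin N) : ℕ) = 3 * v + 3 :=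
    RGate.val_ofNat (by omega)
  have hnd : ts.Nodup := by
    refine List.Nodup.map_on ?_ List.nodup_range'
    intro v hv w hw e
    rw [List.mem_range'_1] at hv hw
    have := congrArg Fin.val e
    rw [hwq (by omega), hwq (by omega)] at this
    omega
  have hlen : ts.length = n := by simp [hts]
  -- Summing over images under the reversible part reduces its column to that of the Hadamard layer.
  rw [← (QGate.listFn_bijective R).sum_comp]
  simp only [QGate.listMatrix_append, QGate.listMatrix_mul_listFn R hRcl,
    QGate.listMatrix_hadamards ts hnd, hlen]
  have hmem (i : Fin N) : i ∈ ts ↔ ∃ w : Fin n, wireQubit N w = i := by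
    simp only [hts, List.mem_map, List.mem_range'_1]
    constructor
    · rintro ⟨v, hv, e⟩
      exact ⟨⟨v, by omega⟩, e⟩
    · rintro ⟨w, e⟩
      exact ⟨w, by omega, e⟩
  have hsupp (x : Fin n → Bool) (i : Fin N) (hi : inputState N x i = true) : i ∈ ts := by
    rw [inputState] at hi
    split_ifs at hi with h
    refine (hmem i).2 ⟨⟨_, h.2.2⟩, Fin.ext ?_⟩
    rw [hwq h.2.2]
    omega
  -- The states supported on the input qubits are exactly those of the form `inputState N x`.
  rw [← Fintype.sum_of_injective (inputState N) (f := fun x : Fin n → Bool =>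
    (1 / (Real.sqrt 2 : ℂ)) ^ n * ((if f.eval x then (-1 : ℂ) else 1) *
      (1 / (Real.sqrt 2 : ℂ)) ^ n))]
  · have hs : (1 / (Real.sqrt 2 : ℂ)) ^ n * (1 / (Real.sqrt 2 : ℂ)) ^ n = 1 / 2 ^ n := by
      rw [← mul_pow, div_mul_div_comm, QGate.sqrt_two_sq, one_mul, div_pow, one_pow]
    rw [gap, Int.cast_sum, Finset.sum_div]
    refine Finset.sum_congr rfl fun x _ => ?_
    rw [mul_left_comm, hs]
    split_ifs <;> simp
    ring
  · intro x y e
    funext w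
    rw [← inputState_wireQubit (N := N) (by omega) x w, e, inputState_wireQubit (by omega)]
  · intro z hz
    rw [if_neg, zero_mul]
    intro h
    apply hz
    refine ⟨fun w => z (wireQubit N w), ?_⟩
    funext i
    by_cases hi : i ∈ ts
    · obtain ⟨w, rfl⟩ := (hmem i).1 hi
      rw [inputState_wireQubit (by omega)]
    · have h1 : z i = false := by
        cases hzi : z i with
        | false => rfl
        | true => exact absurd (h i hzi) hi
      rw [h1]
      by_contra h2
      exact hi (hsupp _ i (by simpa using h2))
  · intro x
    rw [if_pos (hsupp x), f.listFn_inputState x]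

theorem acceptProb_gapCircuit_eq_zero_iff (d : ℕ) :
    (f.gapCircuit d).acceptProb = 0 ↔ f.gap = 0 := by
  rw [QCircuit.acceptProb, sq_eq_zero_iff, norm_eq_zero, unitary_gapCircuit, div_eq_zero_iff,
    or_iff_left (pow_ne_zero _ two_ne_zero), Int.cast_eq_zero]

/-- Expresses the description through gates with natural-number operands, which is what the
translating machine prints. -/
theorem encode_gapCircuit (d : ℕ) : (f.gapCircuit d).encode =
    encodeNat (3 * (n + f.size) + 3) ++
      (f.gapGates d).flatMap (fun g => true :: g.encode) ++ [false] := by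
  have (L : List RGate) (hL : ∀ r ∈ L, r.Valid (3 * (n + f.size) + 3)) :
      (L.map (RGate.toQ (3 * (n + f.size) + 3))).flatMap (fun g => true :: g.encode) =
        L.flatMap (fun g => true :: g.encode) := by
    rw [List.flatMap_map]
    refine List.flatMap_congr fun r hr => ?_
    rw [RGate.encode_toQ (hL r hr)]
  rw [QCircuit.encode]
  exact congrArg (fun l => encodeNat (3 * (n + f.size) + 3) ++ l ++ [false])
    (this _ (f.gapGates_valid d))

end BoolCircuit

/-! ### Structured programs on Turing machine tapes -/

abbrev Tapes (κ : Type) (g : ℕ) : Type := κ → Turing.Tape (Symbol g)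

def Tapes.heads {κ : Type} {g : ℕ} (T : Tapes κ g) : κ → Symbol g := fun k => (T k).head

/-- Write on every tape and move the heads. -/
def Tapes.act {κ : Type} {g : ℕ} (T : Tapes κ g) (w : κ → Symbol g × Option Turing.Dir) :
    Tapes κ g := fun k => Machine.act (T k) (w k)

theorem Machine.act_idle {g : ℕ} (T : Turing.Tape (Symbol g)) : Machine.act T (T.head, none) = T :=
  Turing.Tape.write_self T

/-- Structured deterministic programs: single steps, composition, branches, and while loops. -/
inductive Prog (κ : Type) (g : ℕ) : Type where
  | prim (φ : (κ → Symbol g) → κ → Symbol g × Option Turing.Dir)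
  | seq (p q : Prog κ g)
  | ite (b : (κ → Symbol g) → Bool) (p q : Prog κ g)
  | loop (b : (κ → Symbol g) → Bool) (p : Prog κ g)

namespace Prog

variable {κ : Type} {g : ℕ}

/-- The control states of a program. -/
def Q : Prog κ g → Type
  | prim _ => Unit
  | seq p q => p.Q ⊕ q.Q
  | ite _ p q => Option (p.Q ⊕ q.Q)
  | loop _ p => Option p.Q

noncomputable instance instFintypeQ : (p : Prog κ g) → Fintype p.Q
  | prim _ => inferInstanceAs (Fintype Unit)
  | seq p q =>
    have := instFintypeQ p
    have := instFintypeQ q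
    inferInstanceAs (Fintype (p.Q ⊕ q.Q))
  | ite _ p q =>
    have := instFintypeQ p
    have := instFintypeQ q
    inferInstanceAs (Fintype (Option (p.Q ⊕ q.Q)))
  | loop _ p =>
    have := instFintypeQ p
    inferInstanceAs (Fintype (Option p.Q))

def start : (p : Prog κ g) → p.Q
  | prim _ => ()
  | seq p _ => Sum.inl p.start
  | ite _ _ _ => (none : Option _)
  | loop _ _ => (none : Option _)

def idle (h : κ → Symbol g) : κ → Symbol g × Option Turing.Dir := fun k => (h k, none)

/-- The next control state (`none` at the end of the program) and the action on the tapes. -/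
def next : (p : Prog κ g) → p.Q → (κ → Symbol g) → Option p.Q × (κ → Symbol g × Option Turing.Dir)
  | prim φ, _, h => (none, φ h)
  | seq p q, s, h =>
    match s with
    | Sum.inl s =>
      (some (((p.next s h).1.map Sum.inl).getD (Sum.inr q.start)), (p.next s h).2)
    | Sum.inr s => ((q.next s h).1.map Sum.inr, (q.next s h).2)
  | ite b p q, s, h =>
    match s with
    | none => (some (some (if b h then Sum.inl p.start else Sum.inr q.start)), idle h)
    | some (Sum.inl s) => ((p.next s h).1.map fun s => some (Sum.inl s), (p.next s h).2)
    | some (Sum.inr s) => ((q.next s h).1.map fun s => some (Sum.inr s), (q.next s h).2)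
  | loop b p, s, h =>
    match s with
    | none => (if b h then some (some p.start) else none, idle h)
    | some s => (some (p.next s h).1, (p.next s h).2)

theorem act_idle (T : Tapes κ g) : T.act (idle T.heads) = T :=
  funext fun k => Machine.act_idle (T k)

/-- From control state `s` and tapes `T` the program ends after exactly `t` steps with tapes
`T'`. -/
inductive Exec (p : Prog κ g) : p.Q → Tapes κ g → ℕ → Tapes κ g → Prop
  | last {s T} (h : (p.next s T.heads).1 = none) :
    Exec p s T 1 (T.act (p.next s T.heads).2)
  | step {s s' T t T'} (h : (p.next s T.heads).1 = some s')
    (h' : Exec p s' (T.act (p.next s T.heads).2) t T') : Exec p s T (t + 1) T'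

/-- The program transforms `T` into `T'` within `t` steps. -/
def Run (p : Prog κ g) (T : Tapes κ g) (t : ℕ) (T' : Tapes κ g) : Prop :=
  ∃ s ≤ t, Exec p p.start T s T'

theorem Exec.seq_right {p q : Prog κ g} {s : q.Q} {T T' : Tapes κ g} {t : ℕ}
    (h : Exec q s T t T') : Exec (seq p q) (Sum.inr s : p.Q ⊕ q.Q) T t T' := by
  induction h with
  | @last s T h =>
    exact Exec.last (p := seq p q) (s := (Sum.inr s : p.Q ⊕ q.Q)) (by simp only [next, h]; rfl)
  | @step s s' T t T' h _ ih =>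
    exact Exec.step (p := seq p q) (s := (Sum.inr s : p.Q ⊕ q.Q)) (by simp only [next, h]; rfl) ih

/-- The last step of `p` itself enters `q.start`, so composition costs no extra step. -/
theorem Exec.seq_left {p q : Prog κ g} {s : p.Q} {T T' T'' : Tapes κ g} {t u : ℕ}
    (h : Exec p s T t T') (h' : Exec q q.start T' u T'') :
    Exec (seq p q) (Sum.inl s : p.Q ⊕ q.Q) T (u + t) T'' := by
  induction h with
  | @last s T h =>
    exact Exec.step (p := seq p q) (s := (Sum.inl s : p.Q ⊕ q.Q)) (by simp only [next, h]; rfl)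
      h'.seq_right
  | @step s s' T t T' h _ ih =>
    exact Exec.step (p := seq p q) (s := (Sum.inl s : p.Q ⊕ q.Q)) (by simp only [next, h]; rfl)
      (ih h')

theorem Exec.ite_left {b : (κ → Symbol g) → Bool} {p q : Prog κ g} {s : p.Q} {T T' : Tapes κ g}
    {t : ℕ} (h : Exec p s T t T') :
    Exec (ite b p q) (some (Sum.inl s) : Option (p.Q ⊕ q.Q)) T t T' := by
  induction h with
  | @last s T h =>
    exact Exec.last (p := ite b p q) (s := (some (Sum.inl s) : Option (p.Q ⊕ q.Q)))
      (by simp only [next, h]; rfl)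
  | @step s s' T t T' h _ ih =>
    exact Exec.step (p := ite b p q) (s := (some (Sum.inl s) : Option (p.Q ⊕ q.Q)))
      (by simp only [next, h]; rfl) ih

theorem Exec.ite_right {b : (κ → Symbol g) → Bool} {p q : Prog κ g} {s : q.Q} {T T' : Tapes κ g}
    {t : ℕ} (h : Exec q s T t T') :
    Exec (ite b p q) (some (Sum.inr s) : Option (p.Q ⊕ q.Q)) T t T' := by
  induction h with
  | @last s T h =>
    exact Exec.last (p := ite b p q) (s := (some (Sum.inr s) : Option (p.Q ⊕ q.Q)))
      (by simp only [next, h]; rfl)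
  | @step s s' T t T' h _ ih =>
    exact Exec.step (p := ite b p q) (s := (some (Sum.inr s) : Option (p.Q ⊕ q.Q)))
      (by simp only [next, h]; rfl) ih

theorem Exec.loop_body {b : (κ → Symbol g) → Bool} {p : Prog κ g} {s : p.Q}
    {T T' T'' : Tapes κ g} {t u : ℕ} (h : Exec p s T t T')
    (h' : Exec (loop b p) (loop b p).start T' u T'') :
    Exec (loop b p) (some s : Option p.Q) T (u + t) T'' := by
  induction h with
  | @last s T h =>
    exact Exec.step (p := loop b p) (s := (some s : Option p.Q)) (by simp only [next, h]; rfl) h'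
  | @step s s' T t T' h _ ih =>
    exact Exec.step (p := loop b p) (s := (some s : Option p.Q)) (by simp only [next, h]) (ih h')

theorem Run.mono {p : Prog κ g} {T T' : Tapes κ g} {t u : ℕ} (h : Run p T t T') (htu : t ≤ u) :
    Run p T u T' :=
  h.imp fun _ h => ⟨h.1.trans htu, h.2⟩

theorem run_prim (φ : (κ → Symbol g) → κ → Symbol g × Option Turing.Dir) (T : Tapes κ g) :
    Run (prim φ) T 1 (T.act (φ T.heads)) :=
  ⟨1, le_refl _, Exec.last (p := prim φ) (s := ()) rfl⟩

theorem Run.seq {p q : Prog κ g} {T T' T'' : Tapes κ g} {t u : ℕ} (h : Run p T t T')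
    (h' : Run q T' u T'') : Run (seq p q) T (t + u) T'' := by
  obtain ⟨t', ht, h⟩ := h
  obtain ⟨u', hu, h'⟩ := h'
  exact ⟨u' + t', by omega, h.seq_left h'⟩

/-- The additional step is the one that reads the heads and branches; it leaves the tapes alone. -/
theorem Run.ite_true {b : (κ → Symbol g) → Bool} {p q : Prog κ g} {T T' : Tapes κ g} {t : ℕ}
    (h : Run p T t T') (hb : b T.heads = true) : Run (ite b p q) T (t + 1) T' := by
  obtain ⟨s, hs, h⟩ := h
  refine ⟨s + 1, by omega, Exec.step (p := ite b p q) (s := (none : Option _))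
    (s' := (some (Sum.inl p.start) : Option (p.Q ⊕ q.Q))) (by simp only [next, hb]; rfl) ?_⟩
  have : T.act ((ite b p q).next (none : Option _) T.heads).2 = T := act_idle T
  rw [this]
  exact h.ite_left

theorem Run.ite_false {b : (κ → Symbol g) → Bool} {p q : Prog κ g} {T T' : Tapes κ g} {t : ℕ}
    (h : Run q T t T') (hb : b T.heads = false) : Run (ite b p q) T (t + 1) T' := by
  obtain ⟨s, hs, h⟩ := h
  refine ⟨s + 1, by omega, Exec.step (p := ite b p q) (s := (none : Option _))
    (s' := (some (Sum.inr q.start) : Option (p.Q ⊕ q.Q))) (by simp only [next, hb]; rfl) ?_⟩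
  have : T.act ((ite b p q).next (none : Option _) T.heads).2 = T := act_idle T
  rw [this]
  exact h.ite_right

theorem run_loop_false {b : (κ → Symbol g) → Bool} (p : Prog κ g) {T : Tapes κ g}
    (hb : b T.heads = false) : Run (loop b p) T 1 T := by
  have h : T.act ((loop b p).next (none : Option _) T.heads).2 = T := act_idle T
  have := Exec.last (p := loop b p) (s := (none : Option _)) (T := T) (by simp [next, hb])
  rw [h] at this
  exact ⟨1, le_refl _, this⟩

theorem Run.loop_true {b : (κ → Symbol g) → Bool} {p : Prog κ g} {T T' T'' : Tapes κ g}
    {t u : ℕ} (h : Run p T t T') (hb : b T.heads = true) (h' : Run (loop b p) T' u T'') :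
    Run (loop b p) T (t + 1 + u) T'' := by
  obtain ⟨s, hs, h⟩ := h
  obtain ⟨s', hs', h'⟩ := h'
  refine ⟨s' + s + 1, by omega, Exec.step (p := loop b p) (s := (none : Option _))
    (s' := (some p.start : Option p.Q)) (by simp only [next, hb]; rfl) ?_⟩
  have : T.act ((loop b p).next (none : Option _) T.heads).2 = T := act_idle T
  rw [this]
  exact h.loop_body h'

end Prog

/-! ### Running a program before a machine -/

namespace Machine

variable (M : Machine)

theorem foldl_step_of_halted (c : M.Cfg) {v : Bool} (h : M.verdict c.state = some v)
    (l : List Bool) : l.foldl M.step c = c := by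
  induction l with
  | nil => rfl
  | cons b l ih =>
    have : M.step c b = c := by simp only [step, h]
    rw [List.foldl_cons, this, ih]

theorem result_append {x l : List Bool} {v : Bool} (h : M.result x l = some v) (l' : List Bool) :
    M.result x (l ++ l') = some v := by
  rw [result, List.foldl_append, M.foldl_step_of_halted _ h]
  exact h

theorem HaltsWithin.mono {M : Machine} {x : List Bool} {t u : ℕ} (h : M.HaltsWithin x t)
    (htu : t ≤ u) : M.HaltsWithin x u := by
  intro ω
  obtain ⟨d, rfl⟩ := Nat.exists_eq_add_of_le htu
  rw [List.ofFn_add]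
  change M.result x ((List.ofFn fun i => ω (Fin.castAdd d i)) ++ _) ≠ none
  cases hv : M.result x (List.ofFn fun i => ω (Fin.castAdd d i)) with
  | none => exact absurd hv (h _)
  | some v =>
    rw [M.result_append hv]
    exact Option.some_ne_none v

theorem haltsWithin_iff_forall_length {x : List Bool} {t : ℕ} :
    M.HaltsWithin x t ↔ ∀ l : List Bool, l.length = t → M.result x l ≠ none := by
  constructor
  · rintro h l rfl
    have := h l.get
    rwa [List.ofFn_get] at this
  · intro h ω
    exact h _ (List.length_ofFn)

/-- Verdicts persist, so an accepting choice string of any length can be padded and then cut to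
length `t`, where its path has already halted. -/
theorem nondetAccepts_iff_of_haltsWithin {x : List Bool} {t : ℕ} (h : M.HaltsWithin x t) :
    M.NondetAccepts x ↔ ∃ ω : Fin t → Bool, M.result x (List.ofFn ω) = some true := by
  constructor
  · rintro ⟨l, hl⟩
    let l' := (l ++ List.replicate t false).take t
    have hl' : l'.length = t := by simp [l']
    have h1 := (M.haltsWithin_iff_forall_length.1 h) l' hl'
    obtain ⟨v, hv⟩ := Option.ne_none_iff_exists'.1 h1
    have h2 := M.result_append hl (List.replicate t false)
    have h3 := M.result_append hv ((l ++ List.replicate t false).drop t)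
    rw [List.take_append_drop, h2] at h3
    refine ⟨fun i => l'.get (i.cast hl'.symm), ?_⟩
    have : List.ofFn (fun i : Fin t => l'.get (i.cast hl'.symm)) = l' := by
      apply List.ext_getElem <;> simp [hl']
    rw [this, hv, h3]
  · rintro ⟨ω, hω⟩
    exact ⟨_, hω⟩

/-- The bridge between the two readings of a machine: a set of coin strings has positive probability
iff it is nonempty. -/
theorem coinAcceptProb_pos_iff {x : List Bool} {t : ℕ} (h : M.HaltsWithin x t) :
    0 < M.coinAcceptProb x t ↔ M.NondetAccepts x := by
  rw [M.nondetAccepts_iff_of_haltsWithin h, coinAcceptProb]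
  rw [div_pos_iff_of_pos_right (by positivity), Nat.cast_pos, Fintype.card_pos_iff]
  exact nonempty_subtype

theorem coinAcceptProb_nonneg (x : List Bool) (t : ℕ) : 0 ≤ M.coinAcceptProb x t := by
  rw [coinAcceptProb]
  positivity

/-- A sampler within a multiplicative error below one decides nondeterministically whether the
acceptance probability is nonzero. -/
theorem Samples.nondetAccepts_iff {M : Machine} {C : QCircuit} {ε τ : ℝ} (hε : ε < 1)
    (h : M.Samples C ε τ) : ∃ t : ℕ, (t : ℝ) ≤ τ ∧ M.HaltsWithin C.encode t ∧
      (M.NondetAccepts C.encode ↔ C.acceptProb ≠ 0) := by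
  obtain ⟨t, ht, hh, hp⟩ := h
  refine ⟨t, ht, hh, ?_⟩
  rw [← M.coinAcceptProb_pos_iff hh]
  have h0 : 0 ≤ C.acceptProb := sq_nonneg _
  have hq := M.coinAcceptProb_nonneg C.encode t
  obtain ⟨h1, h2⟩ := abs_le.1 hp
  constructor
  · intro hpos he
    -- If `p_acc = 0`, the error bound forces `q_acc = 0`.
    rw [he] at h1
    linarith
  · intro hne
    -- Here `q_acc ≥ (1 - ε) * p_acc > 0`.
    have hpos : 0 < C.acceptProb := lt_of_le_of_ne h0 (Ne.symm hne)
    nlinarith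

/-- The numbering of `r + 1` tapes followed by `m + 1` tapes. -/
def tapeIdx (r m : ℕ) : Fin (r + 1) ⊕ Fin (m + 1) ≃ Fin (r + 1 + m + 1) := finSumFinEquiv

/-- The machine that runs the program `p` and then `M`, whose tapes are the last ones. -/
noncomputable def afterProg {r : ℕ} (p : Prog (Fin (r + 1) ⊕ Fin (M.numTapes + 1)) M.numSymbols) :
    Machine where
  numTapes := r + 1 + M.numTapes
  numSymbols := M.numSymbols
  numStates := Fintype.card (p.Q ⊕ Fin M.numStates)
  start := Fintype.equivFin _ (Sum.inl p.start)
  verdict s :=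
    match (Fintype.equivFin (p.Q ⊕ Fin M.numStates)).symm s with
    | Sum.inl _ => none
    | Sum.inr s => M.verdict s
  δ b s h :=
    match (Fintype.equivFin (p.Q ⊕ Fin M.numStates)).symm s with
    | Sum.inl s =>
      (Fintype.equivFin _ (((p.next s fun k => h (tapeIdx r M.numTapes k)).1.map Sum.inl).getD
        (Sum.inr M.start)),
        fun k => (p.next s fun k => h (tapeIdx r M.numTapes k)).2 ((tapeIdx r M.numTapes).symm k))
    | Sum.inr s =>
      (Fintype.equivFin _ (Sum.inr (M.δ b s fun j => h (tapeIdx r M.numTapes (Sum.inr j))).1),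
        fun k =>
          match (tapeIdx r M.numTapes).symm k with
          | Sum.inl _ => (h k, none)
          | Sum.inr j => (M.δ b s fun j => h (tapeIdx r M.numTapes (Sum.inr j))).2 j)

variable {r : ℕ} (p : Prog (Fin (r + 1) ⊕ Fin (M.numTapes + 1)) M.numSymbols)

/-- The configuration of the combined machine. -/
noncomputable def afterProgCfg (s : p.Q ⊕ Fin M.numStates)
    (T : Tapes (Fin (r + 1) ⊕ Fin (M.numTapes + 1)) M.numSymbols) : (M.afterProg p).Cfg where
  state := Fintype.equivFin (p.Q ⊕ Fin M.numStates) s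
  tape k := T ((tapeIdx r M.numTapes).symm k)

theorem verdict_afterProgCfg_inl (s : p.Q)
    (T : Tapes (Fin (r + 1) ⊕ Fin (M.numTapes + 1)) M.numSymbols) :
    (M.afterProg p).verdict (M.afterProgCfg p (Sum.inl s) T).state = none := by
  simp only [afterProg, afterProgCfg, Equiv.symm_apply_apply]

theorem verdict_afterProgCfg_inr (s : Fin M.numStates)
    (T : Tapes (Fin (r + 1) ⊕ Fin (M.numTapes + 1)) M.numSymbols) :
    (M.afterProg p).verdict (M.afterProgCfg p (Sum.inr s) T).state = M.verdict s := by
  simp only [afterProg, afterProgCfg, Equiv.symm_apply_apply]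

theorem heads_afterProgCfg (s : p.Q ⊕ Fin M.numStates)
    (T : Tapes (Fin (r + 1) ⊕ Fin (M.numTapes + 1)) M.numSymbols)
    (k : Fin (r + 1) ⊕ Fin (M.numTapes + 1)) :
    ((M.afterProgCfg p s T).tape (tapeIdx r M.numTapes k)).head = T.heads k := by
  change (T ((tapeIdx r M.numTapes).symm (tapeIdx r M.numTapes k))).head = _
  rw [Equiv.symm_apply_apply]
  rfl

theorem step_afterProgCfg_inl (s : p.Q)
    (T : Tapes (Fin (r + 1) ⊕ Fin (M.numTapes + 1)) M.numSymbols) (b : Bool) :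
    (M.afterProg p).step (M.afterProgCfg p (Sum.inl s) T) b =
      M.afterProgCfg p (((p.next s T.heads).1.map Sum.inl).getD (Sum.inr M.start))
        (T.act (p.next s T.heads).2) := by
  rw [step, verdict_afterProgCfg_inl]
  have h : (fun k => ((M.afterProgCfg p (Sum.inl s) T).tape (tapeIdx r M.numTapes k)).head) = T.heads :=
    funext (M.heads_afterProgCfg p _ T)
  have h' : (M.afterProg p).δ b (M.afterProgCfg p (Sum.inl s) T).state
      (fun k => ((M.afterProgCfg p (Sum.inl s) T).tape k).head) =
      (Fintype.equivFin _ (((p.next s T.heads).1.map Sum.inl).getD (Sum.inr M.start)),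
        fun k => (p.next s T.heads).2 ((tapeIdx r M.numTapes).symm k)) := by
    rw [← h]
    simp only [afterProg]
    simp only [afterProgCfg, Equiv.symm_apply_apply]
  simp only [h']
  rfl

/-- Agreement is demanded only on the tapes of `M`; the work tapes may hold whatever the program
left there. -/
theorem step_afterProgCfg_inr (c : M.Cfg)
    (T : Tapes (Fin (r + 1) ⊕ Fin (M.numTapes + 1)) M.numSymbols)
    (hT : ∀ j, T (Sum.inr j) = c.tape j) (b : Bool) :
    ∃ T' : Tapes (Fin (r + 1) ⊕ Fin (M.numTapes + 1)) M.numSymbols,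
      (M.afterProg p).step (M.afterProgCfg p (Sum.inr c.state) T) b =
        M.afterProgCfg p (Sum.inr (M.step c b).state) T' ∧
      ∀ j, T' (Sum.inr j) = (M.step c b).tape j := by
  rw [step, verdict_afterProgCfg_inr, step]
  cases hv : M.verdict c.state with
  | some v => exact ⟨T, rfl, hT⟩
  | none =>
    have h : (fun j => ((M.afterProgCfg p (Sum.inr c.state) T).tape
        (tapeIdx r M.numTapes (Sum.inr j))).head) = fun j => (c.tape j).head := by
      funext j
      rw [M.heads_afterProgCfg p _ T, Tapes.heads, hT]
    refine ⟨T.act fun k => match k with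
      | Sum.inl i => ((T (Sum.inl i)).head, none)
      | Sum.inr j => (M.δ b c.state fun j => (c.tape j).head).2 j, ?_, ?_⟩
    · have h' : (M.afterProg p).δ b (M.afterProgCfg p (Sum.inr c.state) T).state
          (fun k => ((M.afterProgCfg p (Sum.inr c.state) T).tape k).head) =
          (Fintype.equivFin _ (Sum.inr (M.δ b c.state fun j => (c.tape j).head).1),
            fun k => match (tapeIdx r M.numTapes).symm k with
              | Sum.inl _ => (((M.afterProgCfg p (Sum.inr c.state) T).tape k).head, none)
              | Sum.inr j => (M.δ b c.state fun j => (c.tape j).head).2 j) := by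
        rw [← h]
        simp only [afterProg]
        simp only [afterProgCfg, Equiv.symm_apply_apply]
      simp only [h']
      simp only [afterProgCfg]
      congr 1
      funext k
      simp only [Tapes.act]
      cases hk : (tapeIdx r M.numTapes).symm k <;> rfl
    · intro j
      simp only [Tapes.act, hT]

theorem foldl_step_afterProgCfg_inr (l : List Bool) (c : M.Cfg)
    (T : Tapes (Fin (r + 1) ⊕ Fin (M.numTapes + 1)) M.numSymbols)
    (hT : ∀ j, T (Sum.inr j) = c.tape j) :
    (M.afterProg p).verdict
      (l.foldl (M.afterProg p).step (M.afterProgCfg p (Sum.inr c.state) T)).state =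
      M.verdict (l.foldl M.step c).state := by
  induction l generalizing c T with
  | nil => exact M.verdict_afterProgCfg_inr p _ T
  | cons b l ih =>
    obtain ⟨T', h, hT'⟩ := M.step_afterProgCfg_inr p c T hT b
    rw [List.foldl_cons, List.foldl_cons, h, ih _ _ hT']

/-- The program ignores its choice bits, so every choice string of length `t` leads to the same
configuration. -/
theorem foldl_step_afterProgCfg_inl {s : p.Q}
    {T T' : Tapes (Fin (r + 1) ⊕ Fin (M.numTapes + 1)) M.numSymbols} {t : ℕ}
    (h : Prog.Exec p s T t T') (l : List Bool) (hl : l.length = t) :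
    l.foldl (M.afterProg p).step (M.afterProgCfg p (Sum.inl s) T) =
      M.afterProgCfg p (Sum.inr M.start) T' := by
  induction h generalizing l with
  | @last s T h =>
    obtain ⟨b, rfl⟩ := List.length_eq_one_iff.1 hl
    rw [List.foldl_cons, List.foldl_nil, step_afterProgCfg_inl, h]
    rfl
  | @step s s' T t T' h _ ih =>
    obtain ⟨b, l, rfl⟩ := List.exists_cons_of_length_eq_add_one hl
    rw [List.foldl_cons, step_afterProgCfg_inl, h]
    exact ih l (by simpa using hl)

/-- The initial tapes of the combined machine. -/
def inputTapes {r k g : ℕ} (x : List Bool) : Tapes (Fin (r + 1) ⊕ Fin (k + 1)) g := fun j =>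
  Turing.Tape.mk₁ (if j = Sum.inl 0 then x.map fun b => some (Sum.inl b) else [])

theorem init_afterProg (x : List Bool) :
    (M.afterProg p).init x = M.afterProgCfg p (Sum.inl p.start) (inputTapes x) := by
  rw [init, afterProgCfg]
  congr 1
  funext k
  rw [inputTapes]
  have : k = 0 ↔ (tapeIdx r M.numTapes).symm k = (Sum.inl 0 : Fin (r + 1) ⊕ Fin (M.numTapes + 1)) := by
    have h0 : tapeIdx r M.numTapes (Sum.inl 0) = 0 := Fin.ext rfl
    have h := (Equiv.symm_apply_eq (tapeIdx r M.numTapes) (x := k) (y := Sum.inl 0)).symm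
    rw [h0] at h
    exact h
  simp only [this]
  rfl

/-- If the program turns the input `x` into `y`, the combined machine behaves on `x` as `M` does on
`y`, after the steps of the program. -/
theorem afterProg_spec {x y : List Bool}
    {T' : Tapes (Fin (r + 1) ⊕ Fin (M.numTapes + 1)) M.numSymbols} {s : ℕ}
    (h : Prog.Run p (inputTapes x) s T') (hT' : ∀ j, T' (Sum.inr j) = (M.init y).tape j) {t : ℕ}
    (ht : M.HaltsWithin y t) :
    (M.afterProg p).HaltsWithin x (s + t) ∧
      ((M.afterProg p).NondetAccepts x ↔ M.NondetAccepts y) := by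
  obtain ⟨u, hu, h⟩ := h
  have key (l l' : List Bool) (hl : l.length = u) :
      (M.afterProg p).result x (l ++ l') = M.result y l' := by
    rw [result, init_afterProg, List.foldl_append, M.foldl_step_afterProgCfg_inl p h l hl]
    exact M.foldl_step_afterProgCfg_inr p l' (M.init y) T' hT'
  have hh : (M.afterProg p).HaltsWithin x (u + t) := by
    rw [haltsWithin_iff_forall_length]
    intro l hl
    rw [← List.take_append_drop u l, key _ _ (by simp [hl])]
    exact M.haltsWithin_iff_forall_length.1 ht _ (by simp [hl])
  refine ⟨hh.mono (by omega), ?_⟩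
  constructor
  · rintro ⟨l, hl⟩
    -- Padding guarantees at least `u` choice bits, so that the part consumed by the program can be
    -- split off.
    have := (M.afterProg p).result_append hl (List.replicate u false)
    rw [← List.take_append_drop u (l ++ _), key _ _ (by simp)] at this
    exact ⟨_, this⟩
  · rintro ⟨l, hl⟩
    exact ⟨List.replicate u false ++ l, by rw [key _ _ (by simp), hl]⟩

end Machine

/-! ### Tapes as stacks -/

/-- An input bit as a tape symbol. -/
abbrev bitSym {g : ℕ} (b : Bool) : Symbol g := some (Sum.inl b)

/-- A tape holding `l` with the head on its first bit. -/
def opened {g : ℕ} (l : List Bool) : Turing.Tape (Symbol g) := Turing.Tape.mk₁ (l.map bitSym)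

/-- A tape holding `l` with the head on the blank before its first bit. -/
def stored {g : ℕ} (l : List Bool) : Turing.Tape (Symbol g) :=
  Turing.Tape.mk₁ (none :: l.map bitSym)

section Stack

variable {g : ℕ}

theorem listBlank_cons_none_nil :
    (Turing.ListBlank.mk [] : Turing.ListBlank (Symbol g)).cons none = Turing.ListBlank.mk [] :=
  Turing.ListBlank.cons_head_tail (Turing.ListBlank.mk [])

theorem opened_eq (l : List Bool) : (opened l : Turing.Tape (Symbol g)) =
    Turing.Tape.mk' (Turing.ListBlank.mk []) (Turing.ListBlank.mk (l.map bitSym)) := rfl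

theorem stored_eq (l : List Bool) : (stored l : Turing.Tape (Symbol g)) =
    Turing.Tape.mk' (Turing.ListBlank.mk [])
      ((Turing.ListBlank.mk (l.map bitSym)).cons none) := by
  rw [Turing.ListBlank.cons_mk]; rfl

/-- Blanks are invisible, so a stack that has been emptied counts as stored again. -/
theorem opened_nil : (opened [] : Turing.Tape (Symbol g)) = stored [] := by
  rw [opened_eq, stored_eq, List.map_nil, listBlank_cons_none_nil]

@[simp] theorem head_opened_cons (b : Bool) (l : List Bool) :
    (opened (b :: l) : Turing.Tape (Symbol g)).head = bitSym b := rfl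

theorem act_stored_open (l : List Bool) :
    Machine.act (stored l : Turing.Tape (Symbol g)) (none, some .right) = opened l := by
  simp only [Machine.act]
  rw [stored_eq, Turing.Tape.write_mk', Turing.Tape.move_right_mk', Turing.ListBlank.head_cons,
    Turing.ListBlank.tail_cons, Turing.ListBlank.tail_cons, listBlank_cons_none_nil, opened_eq]

theorem act_opened_pop (b : Bool) (l : List Bool) :
    Machine.act (opened (b :: l) : Turing.Tape (Symbol g)) (none, some .right) = opened l := by
  simp only [Machine.act]
  rw [opened_eq, List.map_cons, ← Turing.ListBlank.cons_mk, Turing.Tape.write_mk',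
    Turing.Tape.move_right_mk', Turing.ListBlank.head_cons,
    Turing.ListBlank.tail_cons, Turing.ListBlank.tail_cons, listBlank_cons_none_nil, opened_eq]

theorem act_stored_push (b : Bool) (l : List Bool) :
    Machine.act (stored l : Turing.Tape (Symbol g)) (bitSym b, some .left) = stored (b :: l) := by
  simp only [Machine.act]
  rw [stored_eq, Turing.Tape.write_mk', Turing.Tape.move_left_mk', stored_eq, List.map_cons,
    ← Turing.ListBlank.cons_mk]
  rfl

end Stack

/-! ### The translation of descriptions of circuits -/

namespace Translate

open Prog

variable {m g : ℕ}

/-- Four work tapes, followed by the tapes of the machine that is run afterwards. -/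
abbrev TIdx (m : ℕ) : Type := Fin 4 ⊕ Fin (m + 1)

/-- The input tape. -/
abbrev tInp : TIdx m := Sum.inl 0
/-- A stack that collects the output. -/
abbrev tFwd : TIdx m := Sum.inl 1
/-- A number in unary. -/
abbrev tCnt : TIdx m := Sum.inl 2
/-- A copy of the number while it is being read. -/
abbrev tTmp : TIdx m := Sum.inl 3
/-- The output tape, filled from right to left. -/
abbrev tBwd : TIdx m := Sum.inr 0

/-- Push a bit on several stacks. -/
def push (J : TIdx m → Bool) (b : Bool) : Prog (TIdx m) g :=
  prim fun h k => if J k then (bitSym b, some .left) else (h k, none)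

/-- Move the top bit of an opened stack to several other stacks. -/
def pop (k₀ : TIdx m) (J : TIdx m → Bool) : Prog (TIdx m) g :=
  prim fun h k =>
    if k = k₀ then (none, some .right) else if J k then (h k₀, some .left) else (h k, none)

/-- Move the contents of a stack to several other stacks. -/
def drain (k₀ : TIdx m) (J : TIdx m → Bool) : Prog (TIdx m) g :=
  seq (pop k₀ fun _ => false) (loop (fun h => (h k₀).isSome) (pop k₀ J))

/-- The tapes that hold given bits; the input tape is opened. -/
def tapes (c : TIdx m → List Bool) : Tapes (TIdx m) g := fun k =>
  if k = tInp then opened (c k) else stored (c k)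

theorem Run.congr {p : Prog (TIdx m) g} {T T' T'' : Tapes (TIdx m) g} {t : ℕ} (h : Run p T t T')
    (e : T' = T'') : Run p T t T'' := e ▸ h

theorem run_push {J : TIdx m → Bool} (hJ : J tInp = false) (b : Bool) (c : TIdx m → List Bool) :
    Run (push J b : Prog (TIdx m) g) (tapes c) 1
      (tapes fun k => if J k then b :: c k else c k) := by
  refine Run.congr (run_prim _ (tapes c)) ?_
  funext k
  by_cases hk : J k = true
  · have : k ≠ tInp := by rintro rfl; simp [hJ] at hk
    simp only [tapes, Tapes.act, if_pos hk, if_neg this, act_stored_push]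
  · rw [Tapes.act, if_neg hk]
    simp only [tapes, if_neg hk]
    exact Machine.act_idle _

theorem run_pop_inp (J : TIdx m → Bool) {b : Bool} {l : List Bool}
    {c : TIdx m → List Bool} (hc : c tInp = b :: l) :
    Run (pop tInp J : Prog (TIdx m) g) (tapes c) 1
      (tapes fun k => if k = tInp then l else if J k then b :: c k else c k) := by
  refine Run.congr (run_prim _ (tapes c)) ?_
  funext k
  by_cases hk : k = tInp
  · subst hk
    simp only [tapes, Tapes.act, if_true, hc, act_opened_pop]
  · by_cases hJk : J k = true
    · have : (tapes c : Tapes (TIdx m) g).heads tInp = bitSym b := by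
        simp only [Tapes.heads, tapes, if_true, hc, head_opened_cons]
      rw [Tapes.act, if_neg hk, if_pos hJk, this]
      simp only [tapes, if_neg hk, if_pos hJk, act_stored_push]
    · rw [Tapes.act, if_neg hk, if_neg hJk]
      exact (Machine.act_idle _).trans (by simp only [tapes, if_neg hk, if_neg hJk])

/-- Stated for arbitrary tapes because, during the loop, the drained stack is opened and `tapes`
does not describe it. -/
theorem run_drain_loop {k₀ : TIdx m} {J : TIdx m → Bool} (hJ : J k₀ = false) (l : List Bool)
    (T : Tapes (TIdx m) g) (s : TIdx m → List Bool) (hl : T k₀ = opened l)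
    (hs : ∀ k, J k = true → T k = stored (s k)) :
    Run (loop (fun h => (h k₀).isSome) (pop k₀ J)) T (2 * l.length + 1)
      (fun k => if k = k₀ then stored [] else if J k then stored (l.reverse ++ s k) else T k) := by
  induction l generalizing T s with
  | nil =>
    refine Run.congr (run_loop_false (pop k₀ J) (T := T) (by rw [Tapes.heads, hl]; rfl)) ?_
    funext k
    by_cases hk : k = k₀
    · rw [if_pos hk, hk, hl, opened_nil]
    · by_cases hJk : J k = true
      · rw [if_neg hk, if_pos hJk, hs k hJk]; rfl
      · rw [if_neg hk, if_neg hJk]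
  | cons b l ih =>
    have hd : T.heads k₀ = bitSym b := by rw [Tapes.heads, hl, head_opened_cons]
    have h1 := run_prim (fun h k => if k = k₀ then (none, some .right) else
      if J k then (h k₀, some .left) else (h k, none)) T
    refine Run.congr ((Run.loop_true h1 (by rw [hd]; rfl)
      (ih _ (fun k => b :: s k) ?_ ?_)).mono (by rw [List.length_cons]; omega)) ?_
    · rw [Tapes.act, if_pos rfl, hl, act_opened_pop]
    · intro k hk
      have hne : k ≠ k₀ := by rintro rfl; simp [hJ] at hk
      rw [Tapes.act, if_neg hne, if_pos hk, hd, hs k hk, act_stored_push]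
    · funext k
      by_cases hk : k = k₀
      · rw [if_pos hk, if_pos hk]
      · by_cases hJk : J k = true
        · simp [hk, hJk]
        · rw [if_neg hk, if_neg hk, if_neg hJk, if_neg hJk, Tapes.act, if_neg hk, if_neg hJk]
          exact Machine.act_idle _

theorem run_drain {k₀ : TIdx m} {J : TIdx m → Bool} (hJ : J k₀ = false) (hk₀ : k₀ ≠ tInp)
    (hJi : J tInp = false) (c : TIdx m → List Bool) :
    Run (drain k₀ J : Prog (TIdx m) g) (tapes c) (2 * (c k₀).length + 2)
      (tapes fun k => if k = k₀ then [] else if J k then (c k₀).reverse ++ c k else c k) := by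
  -- This first move transfers nothing: it takes the head from the blank in front of the stack to
  -- its first bit.
  have h1 := run_prim (fun h k => if k = k₀ then (none, some .right) else
      if (fun _ => false) k then (h k₀, some .left) else (h k, none)) (tapes c : Tapes (TIdx m) g)
  refine Run.congr ((h1.seq (run_drain_loop hJ (c k₀) _ c ?_ ?_)).mono (by omega)) ?_
  · rw [Tapes.act, if_pos rfl, tapes, if_neg hk₀, act_stored_open]
  · intro k hk
    have hne : k ≠ k₀ := by rintro rfl; simp [hJ] at hk
    have hne' : k ≠ tInp := by rintro rfl; simp [hJi] at hk
    rw [Tapes.act, if_neg hne]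
    exact (Machine.act_idle _).trans (if_neg hne')
  · funext k
    by_cases hk : k = k₀
    · rw [tapes, if_pos hk, if_pos hk, hk, if_neg hk₀]
    · by_cases hJk : J k = true
      · have hne' : k ≠ tInp := by rintro rfl; simp [hJi] at hJk
        simp [tapes, hk, hJk, hne']
      · rw [if_neg hk, if_neg hJk, Tapes.act, if_neg hk]
        exact (Machine.act_idle _).trans (by simp only [tapes, if_neg hk, if_neg hJk])

/-- The contents of the tapes between two instructions. -/
def st (inp fwd : List Bool) (cnt : ℕ) (bwd : List Bool) : TIdx m → List Bool := fun k =>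
  if k = tInp then inp else if k = tFwd then fwd else if k = tCnt then List.replicate cnt true
  else if k = tBwd then bwd else []

/-- Only the tape `k₀`. -/
def only (k₀ : TIdx m) : TIdx m → Bool := fun k => decide (k = k₀)

/-- Both tapes that collect the output. -/
def outs : TIdx m → Bool := fun k => decide (k = tFwd ∨ k = tBwd)

/-- Output symbols: a bit, or as many ones as the number on the tape `tCnt` says. -/
inductive Tok where
  | lit (b : Bool)
  | cnt

def Tok.expand (c : ℕ) : Tok → List Bool
  | lit b => [b]
  | cnt => List.replicate c true

def expand (c : ℕ) (ts : List Tok) : List Bool := ts.flatMap (Tok.expand c)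

theorem expand_append (c : ℕ) (ts ts' : List Tok) :
    expand c (ts ++ ts') = expand c ts ++ expand c ts' := List.flatMap_append

theorem expand_cons (c : ℕ) (t : Tok) (ts : List Tok) :
    expand c (t :: ts) = t.expand c ++ expand c ts := rfl

theorem Tok.reverse_expand (c : ℕ) (t : Tok) : (t.expand c).reverse = t.expand c := by
  cases t <;> simp [Tok.expand]

/-- Each token expands to a constant word, so reversing the tokens reverses the output. -/
theorem expand_reverse (c : ℕ) (ts : List Tok) :
    (expand c ts.reverse).reverse = expand c ts := by
  induction ts with
  | nil => rfl
  | cons t ts ih =>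
    rw [List.reverse_cons, expand_append, List.reverse_append, ih, expand_cons, expand_cons]
    simp [expand, Tok.reverse_expand]

/-- Reading a stack destroys it, so the counter is drained to the target and to `tTmp`, and then
restored from there. -/
def pushTok (k₀ : TIdx m) : Tok → Prog (TIdx m) g
  | .lit b => push (only k₀) b
  | .cnt => seq (drain tCnt fun k => decide (k = tTmp ∨ k = k₀)) (drain tTmp (only tCnt))

def pushToks (k₀ : TIdx m) : List Tok → Prog (TIdx m) g
  | [] => prim idle
  | t :: ts => seq (pushTok k₀ t) (pushToks k₀ ts)

theorem Run.to {p : Prog (TIdx m) g} {T : Tapes (TIdx m) g} {t : ℕ} {c c' : TIdx m → List Bool}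
    (h : Run p T t (tapes c)) (hc : c = c') : Run p T t (tapes c') := hc ▸ h

theorem run_pushTok_fwd (t : Tok) (i f b : List Bool) (c : ℕ) :
    Run (pushTok tFwd t : Prog (TIdx m) g) (tapes (st i f c b)) (4 * c + 4)
      (tapes (st i ((t.expand c).reverse ++ f) c b)) := by
  cases t with
  | lit v =>
    refine Run.to ((run_push (by simp [only]) v _).mono (by omega)) ?_
    funext k
    simp only [st, only, decide_eq_true_eq]
    split_ifs <;> simp_all [Tok.expand]
  | cnt =>
    refine Run.to (((run_drain (by simp) (by simp) (by simp) _).seq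
      (run_drain (by simp [only]) (by simp) (by simp [only]) _)).mono ?_) ?_
    · simp [st]; omega
    · funext k
      simp only [st, only, decide_eq_true_eq]
      split_ifs <;> simp_all [Tok.expand]

theorem run_pushTok_bwd (t : Tok) (i f b : List Bool) (c : ℕ) :
    Run (pushTok tBwd t : Prog (TIdx m) g) (tapes (st i f c b)) (4 * c + 4)
      (tapes (st i f c ((t.expand c).reverse ++ b))) := by
  cases t with
  | lit v =>
    refine Run.to ((run_push (by simp [only]) v _).mono (by omega)) ?_
    funext k
    simp only [st, only, decide_eq_true_eq]
    split_ifs <;> simp_all [Tok.expand]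
  | cnt =>
    refine Run.to (((run_drain (by simp) (by simp) (by simp) _).seq
      (run_drain (by simp [only]) (by simp) (by simp [only]) _)).mono ?_) ?_
    · simp [st]; omega
    · funext k
      simp only [st, only, decide_eq_true_eq]
      split_ifs <;> simp_all [Tok.expand]

theorem run_idle (T : Tapes (TIdx m) g) : Run (prim idle) T 1 T := by
  have := run_prim idle T
  rwa [act_idle] at this

theorem run_pushToks_fwd (ts : List Tok) (i f b : List Bool) (c : ℕ) :
    Run (pushToks tFwd ts : Prog (TIdx m) g) (tapes (st i f c b)) (ts.length * (4 * c + 4) + 1)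
      (tapes (st i ((expand c ts).reverse ++ f) c b)) := by
  induction ts generalizing f with
  | nil => exact (run_idle _).mono (by omega)
  | cons t ts ih =>
    refine Run.to (((run_pushTok_fwd t i f b c).seq (ih _)).mono ?_) ?_
    · rw [List.length_cons, add_mul]; omega
    · rw [expand_cons, List.reverse_append, List.append_assoc]

theorem run_pushToks_bwd (ts : List Tok) (i f b : List Bool) (c : ℕ) :
    Run (pushToks tBwd ts : Prog (TIdx m) g) (tapes (st i f c b)) (ts.length * (4 * c + 4) + 1)
      (tapes (st i f c ((expand c ts).reverse ++ b))) := by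
  induction ts generalizing b with
  | nil => exact (run_idle _).mono (by omega)
  | cons t ts ih =>
    refine Run.to (((run_pushTok_bwd t i f b c).seq (ih _)).mono ?_) ?_
    · rw [List.length_cons, add_mul]; omega
    · rw [expand_cons, List.reverse_append, List.append_assoc]

/-- Output a gate. -/
def emit (ts : List Tok) : Prog (TIdx m) g := seq (pushToks tFwd ts) (pushToks tBwd ts.reverse)

/-- A stack reverses what is pushed. On `tBwd` each gate stays readable but the order of gates is
reversed, as the second half of the circuit requires. On `tFwd` everything is reversed bit by bit,
and a final drain restores the original order. -/
theorem run_emit (ts : List Tok) (i f b : List Bool) (c : ℕ) :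
    Run (emit ts : Prog (TIdx m) g) (tapes (st i f c b)) (2 * (ts.length * (4 * c + 4)) + 2)
      (tapes (st i ((expand c ts).reverse ++ f) c (expand c ts ++ b))) := by
  refine Run.to (((run_pushToks_fwd ts i f b c).seq (run_pushToks_bwd ts.reverse i _ b c)).mono
    ?_) ?_
  · rw [List.length_reverse]; omega
  · rw [expand_reverse]

/-- Is the next input bit a one? -/
def isOne (h : TIdx m → Symbol g) : Bool := decide (h tInp = bitSym true)

theorem isOne_st (v : Bool) (i f b : List Bool) (c : ℕ) :
    isOne (tapes (st (v :: i) f c b) : Tapes (TIdx m) g).heads = v := by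
  have : (tapes (st (v :: i) f c b) : Tapes (TIdx m) g).heads tInp = bitSym v := rfl
  rw [isOne, this]
  cases v <;> simp

/-- Skip an input bit. -/
def skip : Prog (TIdx m) g := pop tInp fun _ => false

theorem run_skip (v : Bool) (i f b : List Bool) (c : ℕ) :
    Run (skip : Prog (TIdx m) g) (tapes (st (v :: i) f c b)) 1 (tapes (st i f c b)) := by
  refine Run.to (run_pop_inp _ (b := v) (l := i) (by simp [st])) ?_
  funext k
  simp only [st]
  split_ifs <;> simp_all

/-- Read a number in unary, and output three times as many ones. -/
def stream : Prog (TIdx m) g :=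
  seq (loop isOne (seq (pop tInp outs) (seq (push outs true) (push outs true)))) skip

theorem run_stream (x : ℕ) (i f b : List Bool) (c : ℕ) :
    Run (stream : Prog (TIdx m) g) (tapes (st (encodeNat x ++ i) f c b)) (4 * x + 2)
      (tapes (st i (List.replicate (3 * x) true ++ f) c (List.replicate (3 * x) true ++ b))) := by
  have h : Run (loop isOne (seq (pop tInp outs) (seq (push outs true) (push outs true))) :
      Prog (TIdx m) g) (tapes (st (encodeNat x ++ i) f c b)) (4 * x + 1)
      (tapes (st (false :: i) (List.replicate (3 * x) true ++ f) c
        (List.replicate (3 * x) true ++ b))) := by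
    induction x generalizing f b with
    | zero => exact run_loop_false _ (isOne_st false i f b c)
    | succ x ih =>
      have h1 : Run (seq (pop tInp outs) (seq (push outs true) (push outs true)) :
          Prog (TIdx m) g) (tapes (st (encodeNat (x + 1) ++ i) f c b)) 3
          (tapes (st (encodeNat x ++ i) (List.replicate 3 true ++ f) c
            (List.replicate 3 true ++ b))) := by
        refine Run.to (((run_pop_inp _ (b := true) (l := encodeNat x ++ i)
          (by simp [st, encodeNat, List.replicate_succ])).seq ((run_push (by simp [outs]) true _).seq
            (run_push (by simp [outs]) true _))).mono (by omega)) ?_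
        funext k
        simp only [st, outs, decide_eq_true_eq]
        split_ifs <;> simp_all
      refine Run.to ((Run.loop_true h1 (isOne_st true _ f b c) (ih _ _)).mono (by omega)) ?_
      rw [← List.append_assoc, ← List.append_assoc, ← List.replicate_add]
      rfl
  exact h.seq (run_skip false _ _ _ _)

/-- Output a gate whose description contains a number from the input. -/
def emitOperand (pre post : List Tok) : Prog (TIdx m) g :=
  seq (pushToks tFwd pre) (seq (pushToks tBwd post.reverse) (seq stream
    (seq (pushToks tFwd post) (pushToks tBwd pre.reverse))))

/-- The operand can be read only once and is streamed to both stacks together. The surrounding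
tokens are therefore pushed in opposite orders on the two stacks. -/
theorem run_emitOperand (pre post : List Tok) (x : ℕ) (i f b : List Bool) (c : ℕ) :
    Run (emitOperand pre post : Prog (TIdx m) g) (tapes (st (encodeNat x ++ i) f c b))
      (2 * ((pre.length + post.length) * (4 * c + 4)) + 4 * x + 6)
      (tapes (st i ((expand c pre ++ List.replicate (3 * x) true ++ expand c post).reverse ++ f) c
        ((expand c pre ++ List.replicate (3 * x) true ++ expand c post) ++ b))) := by
  refine Run.to (((run_pushToks_fwd pre _ f b c).seq ((run_pushToks_bwd post.reverse _ _ b c).seq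
    ((run_stream x i _ _ c).seq ((run_pushToks_fwd post i _ _ c).seq
      (run_pushToks_bwd pre.reverse i _ _ c))))).mono ?_) ?_
  · rw [List.length_reverse, List.length_reverse, add_mul]; omega
  · rw [expand_reverse, expand_reverse]
    simp

/-- Add three to the number on the tape `tCnt`. -/
def inc : Prog (TIdx m) g :=
  seq (push (only tCnt) true) (seq (push (only tCnt) true) (push (only tCnt) true))

theorem run_inc (i f b : List Bool) (c : ℕ) :
    Run (inc : Prog (TIdx m) g) (tapes (st i f c b)) 3 (tapes (st i f (c + 3) b)) := by
  refine Run.to (((run_push (by simp [only]) true _).seq ((run_push (by simp [only]) true _).seq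
    (run_push (by simp [only]) true _))).mono (by omega)) ?_
  funext k
  simp only [st, only, decide_eq_true_eq]
  split_ifs <;> simp_all [List.replicate_succ]

/-- The number on the tape `tCnt`, increased by `e`, in unary. -/
def numToks (e : ℕ) : List Tok := .cnt :: (List.replicate e (.lit true) ++ [.lit false])

theorem expand_numToks (c e : ℕ) : expand c (numToks e) = encodeNat (c + e) := by
  have (e : ℕ) : expand c (List.replicate e (.lit true)) = List.replicate e true := by
    induction e with
    | zero => rfl
    | succ e ih => rw [List.replicate_succ, expand_cons, ih]; rfl
  rw [numToks, expand_cons, expand_append, this, encodeNat, List.replicate_add, List.append_assoc]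
  rfl

theorem length_numToks (e : ℕ) : (numToks e).length = e + 2 := by simp [numToks]

def xToks (e : ℕ) : List Tok := .lit true :: .lit false :: .lit false :: numToks e

def hadToks (e : ℕ) : List Tok := .lit true :: .lit true :: .lit true :: numToks e

def toffToks : List Tok :=
  .lit true :: .lit true :: .lit false :: (numToks 1 ++ (numToks 2 ++ numToks 0))

theorem expand_xToks (c e : ℕ) : expand c (xToks e) = true :: (RGate.x (c + e)).encode := by
  simp only [xToks, expand_cons, expand_numToks]; rfl

theorem expand_hadToks (c e : ℕ) : expand c (hadToks e) = true :: (RGate.had (c + e)).encode := by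
  simp only [hadToks, expand_cons, expand_numToks]; rfl

theorem expand_toffToks (c : ℕ) :
    expand c toffToks = true :: (RGate.toff (c + 1) (c + 2) c).encode := by
  simp only [toffToks, expand_cons, expand_append, expand_numToks, RGate.encode,
    List.append_assoc]
  rfl

/-- The CNOT gate controlled by the qubit of the wire that is next in the input. -/
def emitCnot (e : ℕ) : Prog (TIdx m) g :=
  emitOperand [.lit true, .lit false, .lit true, .lit true, .lit true, .lit true]
    (.lit false :: numToks e)

/-- The description of a list of gates. -/
def encodeGates (L : List RGate) : List Bool := L.flatMap fun g => true :: g.encode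

theorem encodeGates_append (L L' : List RGate) :
    encodeGates (L ++ L') = encodeGates L ++ encodeGates L' := List.flatMap_append

theorem encodeGates_singleton (r : RGate) : encodeGates [r] = true :: r.encode := by
  simp [encodeGates]

/-- The contents of the tapes after output of the gates `L`. -/
def stOut (inp : List Bool) (L : List RGate) (cnt : ℕ) (L' : List RGate) (z : List Bool) :
    TIdx m → List Bool :=
  st inp (encodeGates L).reverse cnt (encodeGates L' ++ z)

theorem stOut_snoc (i : List Bool) (L : List RGate) (c : ℕ) (L' : List RGate) (z : List Bool)
    (r : RGate) : (stOut i (L ++ [r]) c (r :: L') z : TIdx m → List Bool) =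
      st i ((true :: r.encode).reverse ++ (encodeGates L).reverse) c
        ((true :: r.encode) ++ (encodeGates L' ++ z)) := by
  rw [stOut, encodeGates_append, List.reverse_append, encodeGates_singleton]
  simp [encodeGates]

theorem run_emitCnot (e x : ℕ) (he : e ≤ 2) (i : List Bool) (L : List RGate) (c : ℕ)
    (L' : List RGate) (z : List Bool) :
    Run (emitCnot e : Prog (TIdx m) g) (tapes (stOut (encodeNat x ++ i) L c L' z))
      (22 * (4 * c + 4) + 4 * x + 6)
      (tapes (stOut i (L ++ [.cnot (3 * x + 3) (c + e)]) c (.cnot (3 * x + 3) (c + e) :: L') z))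
      := by
  refine Run.to ((run_emitOperand _ _ x i _ _ c).mono ?_) ?_
  · simp only [List.length_cons, List.length_nil, length_numToks]
    have : (0 + 1 + 1 + 1 + 1 + 1 + 1 + (e + 2 + 1)) * (4 * c + 4) ≤ 11 * (4 * c + 4) :=
      Nat.mul_le_mul_right _ (by omega)
    omega
  · rw [stOut_snoc]
    -- The first literal is the gate marker, the next two are the tag of CNOT, and the last three
    -- are the summand in `3 * x + 3`.
    have h : expand c [.lit true, .lit false, .lit true, .lit true, .lit true, .lit true] ++
        List.replicate (3 * x) true ++ expand c (.lit false :: numToks e) =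
        true :: (RGate.cnot (3 * x + 3) (c + e)).encode := by
      rw [expand_cons _ (.lit false), expand_numToks]
      simp [expand, Tok.expand, RGate.encode, encodeNat, List.replicate_succ]
    rw [h]

theorem run_emitX (e : ℕ) (he : e ≤ 2) (i : List Bool) (L : List RGate) (c : ℕ)
    (L' : List RGate) (z : List Bool) :
    Run (emit (xToks e) : Prog (TIdx m) g) (tapes (stOut i L c L' z)) (14 * (4 * c + 4) + 2)
      (tapes (stOut i (L ++ [.x (c + e)]) c (.x (c + e) :: L') z)) := by
  refine Run.to ((run_emit _ i _ _ c).mono ?_) ?_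
  · simp only [xToks, List.length_cons, length_numToks]
    have : (e + 2 + 1 + 1 + 1) * (4 * c + 4) ≤ 7 * (4 * c + 4) :=
      Nat.mul_le_mul_right _ (by omega)
    omega
  · rw [stOut_snoc, expand_xToks]

theorem run_emitHad (i : List Bool) (L : List RGate) (c : ℕ) (L' : List RGate) (z : List Bool) :
    Run (emit (hadToks 0) : Prog (TIdx m) g) (tapes (stOut i L c L' z)) (10 * (4 * c + 4) + 2)
      (tapes (stOut i (L ++ [.had c]) c (.had c :: L') z)) := by
  refine Run.to ((run_emit _ i _ _ c).mono ?_) ?_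
  · simp only [hadToks, List.length_cons, length_numToks]
    omega
  · rw [stOut_snoc, expand_hadToks]
    rfl

theorem run_emitToff (i : List Bool) (L : List RGate) (c : ℕ) (L' : List RGate) (z : List Bool) :
    Run (emit toffToks : Prog (TIdx m) g) (tapes (stOut i L c L' z)) (24 * (4 * c + 4) + 2)
      (tapes (stOut i (L ++ [.toff (c + 1) (c + 2) c]) c (.toff (c + 1) (c + 2) c :: L') z)) := by
  refine Run.to ((run_emit _ i _ _ c).mono ?_) ?_
  · simp only [toffToks, List.length_cons, List.length_append, length_numToks]
    omega
  · rw [stOut_snoc, expand_toffToks]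

end Translate

theorem length_flatMap_le {α β : Type} (L : List α) (F : α → List β) (B : ℕ)
    (h : ∀ r ∈ L, (F r).length ≤ B) : (L.flatMap F).length ≤ L.length * B := by
  induction L with
  | nil => simp
  | cons r L ih =>
    have h1 := h r List.mem_cons_self
    have h2 := ih fun r hr => h r (List.mem_cons_of_mem _ hr)
    rw [List.flatMap_cons, List.length_append, List.length_cons, add_mul]
    omega

theorem RGate.length_encode_le {N : ℕ} {r : RGate} (h : r.Valid N) :
    r.encode.length ≤ 3 * N + 2 := by
  cases r <;> simp only [RGate.Valid] at h <;> simp [RGate.encode, encodeNat] <;> omega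

/-! ### The translating program and its running time -/

namespace Translate

open Prog

variable {m g : ℕ}

theorem run_skip_stOut (v : Bool) (i : List Bool) (L : List RGate) (c : ℕ) (L' : List RGate)
    (z : List Bool) : Run (skip : Prog (TIdx m) g) (tapes (stOut (v :: i) L c L' z)) 1
      (tapes (stOut i L c L' z)) :=
  run_skip v i _ _ c

theorem run_inc_stOut (i : List Bool) (L : List RGate) (c : ℕ) (L' : List RGate)
    (z : List Bool) : Run (inc : Prog (TIdx m) g) (tapes (stOut i L c L' z)) 3
      (tapes (stOut i L (c + 3) L' z)) :=
  run_inc i _ _ c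

theorem isOne_stOut (v : Bool) (i : List Bool) (L : List RGate) (c : ℕ) (L' : List RGate)
    (z : List Bool) : isOne (tapes (stOut (v :: i) L c L' z) : Tapes (TIdx m) g).heads = v :=
  isOne_st v i _ _ c

/-- Translate one input wire. -/
def wireProg : Prog (TIdx m) g := seq skip (seq inc (emit (hadToks 0)))

/-- The counter is raised by three before each gate is emitted, so it then shows the qubit of the
current wire. The uniform bound `W` makes the cost per iteration constant. -/
theorem run_wireLoop {n w W : ℕ} (hW : w + n ≤ W) (i : List Bool) (L L' : List RGate)
    (z : List Bool) :
    Run (loop isOne wireProg : Prog (TIdx m) g)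
      (tapes (stOut (encodeNat n ++ i) L (3 * w) L' z)) (n * (120 * W + 60) + 1)
      (tapes (stOut (false :: i) (L ++ hadBlock w n) (3 * (w + n))
        ((hadBlock w n).reverse ++ L') z)) := by
  induction n generalizing w L L' with
  | zero =>
    refine Run.to ((run_loop_false _ (isOne_stOut false i L (3 * w) L' z)).mono (by omega)) ?_
    simp [hadBlock]
  | succ n ih =>
    have h1 : Run (wireProg : Prog (TIdx m) g)
        (tapes (stOut (encodeNat (n + 1) ++ i) L (3 * w) L' z)) (120 * W + 59)
        (tapes (stOut (encodeNat n ++ i) (L ++ [.had (3 * w + 3)]) (3 * (w + 1))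
          (.had (3 * w + 3) :: L') z)) :=
      ((run_skip_stOut true _ L _ L' z).seq ((run_inc_stOut _ L _ L' z).seq
        (run_emitHad _ L _ L' z))).mono (by omega)
    refine Run.to ((Run.loop_true h1 (isOne_stOut true _ L _ L' z) (ih (by omega) _ _)).mono
      ?_) ?_
    · rw [add_mul]; omega
    · simp [hadBlock, List.range'_succ, add_assoc, add_comm 1]

/-- Translate one gate. -/
def gateProg : Prog (TIdx m) g :=
  seq skip (seq inc (ite isOne
    (seq skip (seq skip (seq (emitCnot 1) (seq (emit (xToks 1)) (seq (emitCnot 2)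
      (seq (emit (xToks 2)) (seq (emit toffToks) (emit (xToks 0)))))))))
    (seq skip (ite isOne
      (seq skip (seq (emitCnot 1) (seq (emitCnot 2) (emit toffToks))))
      (seq skip (seq (emitCnot 0) (emit (xToks 0))))))))

/-- A first tag bit one means OR; otherwise the second tag bit separates AND from NOT. -/
theorem run_gateProg {G : BGate} {w W : ℕ} (hG : G.UsesBelow w) (hW : w ≤ W) (i : List Bool)
    (L L' : List RGate) (z : List Bool) :
    Run (gateProg : Prog (TIdx m) g)
      (tapes (stOut (true :: G.encode ++ i) L (3 * w) L' z)) (3000 * W + 2999)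
      (tapes (stOut i (L ++ gateBlock w G) (3 * (w + 1)) ((gateBlock w G).reverse ++ L') z)) := by
  cases G with
  | not x =>
    have hx : x < w := hG
    refine Run.to (((run_skip_stOut true _ L _ L' z).seq ((run_inc_stOut _ L _ L' z).seq
      (Run.ite_false ((run_skip_stOut false _ L _ L' z).seq (Run.ite_false
        ((run_skip_stOut false _ L _ L' z).seq ((run_emitCnot 0 x (by omega) _ L _ L' z).seq
          (run_emitX 0 (by omega) _ _ _ _ z))) (isOne_stOut false _ L _ L' z)))
          (isOne_stOut false _ L _ L' z)))).mono (by omega)) ?_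
    simp [gateBlock, mul_add]
  | and x y =>
    have hx : x < w := hG.1
    have hy : y < w := hG.2
    have e : true :: (BGate.and x y).encode ++ i =
        true :: false :: true :: (encodeNat x ++ (encodeNat y ++ i)) := by simp [BGate.encode]
    rw [e]
    refine Run.to (((run_skip_stOut true _ L _ L' z).seq ((run_inc_stOut _ L _ L' z).seq
      (Run.ite_false ((run_skip_stOut false _ L _ L' z).seq (Run.ite_true
        ((run_skip_stOut true _ L _ L' z).seq ((run_emitCnot 1 x (by omega) _ L _ L' z).seq
          ((run_emitCnot 2 y (by omega) _ _ _ _ z).seq (run_emitToff _ _ _ _ z))))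
          (isOne_stOut true _ L _ L' z)))
          (isOne_stOut false _ L _ L' z)))).mono (by omega)) ?_
    simp [gateBlock, mul_add]
  | or x y =>
    have hx : x < w := hG.1
    have hy : y < w := hG.2
    have e : true :: (BGate.or x y).encode ++ i =
        true :: true :: false :: (encodeNat x ++ (encodeNat y ++ i)) := by simp [BGate.encode]
    rw [e]
    refine Run.to (((run_skip_stOut true _ L _ L' z).seq ((run_inc_stOut _ L _ L' z).seq
      (Run.ite_true ((run_skip_stOut true _ L _ L' z).seq
        ((run_skip_stOut false _ L _ L' z).seq ((run_emitCnot 1 x (by omega) _ L _ L' z).seq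
          ((run_emitX 1 (by omega) _ _ _ _ z).seq ((run_emitCnot 2 y (by omega) _ _ _ _ z).seq
          ((run_emitX 2 (by omega) _ _ _ _ z).seq ((run_emitToff _ _ _ _ z).seq
          (run_emitX 0 (by omega) _ _ _ _ z))))))))
          (isOne_stOut true _ L _ L' z)))).mono (by omega)) ?_
    simp [gateBlock, mul_add]

theorem run_gateLoop {gs : List BGate} {w W : ℕ}
    (hgs : ∀ (k : ℕ) (hk : k < gs.length), (gs[k]).UsesBelow (w + k)) (hW : w + gs.length ≤ W)
    (i : List Bool) (L L' : List RGate) (z : List Bool) :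
    Run (loop isOne gateProg : Prog (TIdx m) g)
      (tapes (stOut (gs.flatMap (fun g => true :: g.encode) ++ false :: i) L (3 * w) L' z))
      (gs.length * (3000 * W + 3000) + 1)
      (tapes (stOut (false :: i) (L ++ gateBlocks w gs) (3 * (w + gs.length))
        ((gateBlocks w gs).reverse ++ L') z)) := by
  induction gs generalizing w L L' with
  | nil =>
    refine Run.to ((run_loop_false _ (isOne_stOut false i L (3 * w) L' z)).mono (by omega)) ?_
    simp [gateBlocks]
  | cons G gs ih =>
    rw [List.length_cons] at hW
    have h1 := run_gateProg (m := m) (g := g) (hgs 0 (by simp)) (show w + 0 ≤ W by omega)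
      (gs.flatMap (fun g => true :: g.encode) ++ false :: i) L L' z
    have h2 := ih (w := w + 1) (fun k hk => by
      have := hgs (k + 1) (by simpa using hk)
      rw [add_assoc, add_comm 1]
      simpa using this) (by omega) (L ++ gateBlock w G) ((gateBlock w G).reverse ++ L')
    rw [List.flatMap_cons, List.append_assoc]
    refine Run.to ((Run.loop_true h1 (isOne_stOut true _ L _ L' z) h2).mono ?_) ?_
    · rw [List.length_cons, add_mul]; omega
    · simp [gateBlocks, add_assoc, add_comm 1]

/-- The phase flip on the last wire and `d` cancelling pairs of Hadamard gates. -/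
def phaseToks (d : ℕ) : List Tok :=
  hadToks 0 ++ xToks 0 ++ hadToks 0 ++
    (List.replicate (2 * d) [Tok.lit true, .lit true, .lit true, .lit false]).flatten

theorem expand_phaseToks (c d : ℕ) : expand c (phaseToks d) = encodeGates (phaseBlock c d) := by
  have h (k : ℕ) : expand c
      (List.replicate k [Tok.lit true, .lit true, .lit true, .lit false]).flatten =
      encodeGates (List.replicate k (.had 0)) := by
    induction k with
    | zero => rfl
    | succ k ih =>
      rw [List.replicate_succ, List.flatten_cons, expand_append, ih, List.replicate_succ]
      rfl
  rw [phaseToks, expand_append, expand_append, expand_append, h, expand_hadToks, expand_xToks,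
    phaseBlock, encodeGates_append]
  simp [encodeGates]

theorem length_phaseToks (d : ℕ) : (phaseToks d).length = 8 * d + 15 := by
  simp [phaseToks, hadToks, xToks, length_numToks]
  omega

/-- Translates descriptions of Boolean circuits to descriptions of quantum circuits. -/
def prog (d : ℕ) : Prog (TIdx m) g :=
  seq (push (only tBwd) false) (seq (loop isOne wireProg) (seq skip (seq (loop isOne gateProg)
    (seq (pushToks tBwd (phaseToks d).reverse) (seq (drain tFwd (only tBwd))
      (seq (pushToks tBwd (numToks 3).reverse) (pop tBwd fun _ => false)))))))

theorem run_open (c : TIdx m → List Bool) (y : List Bool) (hc : c tBwd = y)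
    (hc' : ∀ j : Fin m, c (Sum.inr j.succ) = []) :
    ∃ T : Tapes (TIdx m) g, Run (pop tBwd (fun _ => false)) (tapes c) 1 T ∧
      ∀ j : Fin (m + 1), T (Sum.inr j) = if j = 0 then opened y else opened [] := by
  refine ⟨_, run_prim _ (tapes c), fun j => ?_⟩
  refine Fin.cases ?_ (fun j => ?_) j
  · rw [if_pos rfl, Tapes.act, if_pos rfl, tapes, if_neg (by simp), hc, act_stored_open]
  · have h1 : (Sum.inr j.succ : TIdx m) ≠ tBwd := by simp [Fin.succ_ne_zero]
    rw [if_neg (Fin.succ_ne_zero j), Tapes.act, if_neg h1, opened_nil]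
    refine (Machine.act_idle _).trans ?_
    rw [tapes, if_neg (by simp), hc']

/-- The output tape is filled from the right: final zero, reversed preparation (during the reading
of the input), phase block, preparation drained from `tFwd`, number of qubits. A last move puts the
head on the first bit, as in an initial configuration. -/
theorem run_prog {n : ℕ} (f : BoolCircuit n) (d : ℕ) :
    ∃ T : Tapes (TIdx m) g,
      Run (prog d) (Machine.inputTapes f.encode) (10000 * (d + 1) * (n + f.size + 1) ^ 2) T ∧
      ∀ j : Fin (m + 1), T (Sum.inr j) =
        if j = 0 then opened (f.gapCircuit d).encode else opened [] := by
  set W := n + f.size with hWdef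
  have hinit : (Machine.inputTapes f.encode : Tapes (TIdx m) g) = tapes (st f.encode [] 0 []) := by
    funext k
    rw [Machine.inputTapes, tapes]
    by_cases hk : k = tInp
    · rw [if_pos hk, if_pos hk, hk]; rfl
    · rw [if_neg hk, if_neg hk]
      have : (st f.encode [] 0 [] : TIdx m → List Bool) k = [] := by
        simp only [st]
        split_ifs <;> first | rfl | contradiction
      rw [this, ← opened_nil]
      rfl
  have e1 : (f.encode : List Bool) = encodeNat n ++
      (f.gates.flatMap (fun g => true :: g.encode) ++ false :: []) := by
    rw [BoolCircuit.encode, List.append_assoc]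
  have r1 : Run (push (only tBwd) false : Prog (TIdx m) g) (tapes (st f.encode [] 0 [])) 1
      (tapes (stOut (encodeNat n ++ (f.gates.flatMap (fun g => true :: g.encode) ++ false :: []))
        [] (3 * 0) [] [false])) := by
    refine Run.to (run_push (by simp [only]) false _) ?_
    funext k
    simp only [stOut, st, only, decide_eq_true_eq, e1]
    split_ifs <;> simp_all [encodeGates]
  have r2 := run_wireLoop (m := m) (g := g) (n := n) (w := 0) (W := W) (by omega)
    (f.gates.flatMap (fun g => true :: g.encode) ++ false :: []) [] [] [false]
  have r3 := run_gateLoop (m := m) (g := g) (W := W) f.uses_below (le_refl _) [] ([] ++ hadBlock 0 n)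
    ((hadBlock 0 n).reverse ++ []) [false]
  have e2 : [] ++ hadBlock 0 n ++ gateBlocks n f.gates = f.prepare := rfl
  have e3 : (gateBlocks n f.gates).reverse ++ ((hadBlock 0 n).reverse ++ []) =
      f.prepare.reverse := by simp [BoolCircuit.prepare]
  rw [e2, e3] at r3
  rw [Nat.zero_add] at r2
  have r4 := run_pushToks_bwd (m := m) (g := g) (phaseToks d).reverse [false]
    (encodeGates f.prepare).reverse (encodeGates f.prepare.reverse ++ [false]) (3 * W)
  rw [expand_reverse, expand_phaseToks, List.length_reverse, length_phaseToks] at r4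
  have r5 : Run (drain tFwd (only tBwd) : Prog (TIdx m) g)
      (tapes (st [false] (encodeGates f.prepare).reverse (3 * W)
        (encodeGates (phaseBlock (3 * W) d) ++ (encodeGates f.prepare.reverse ++ [false]))))
      (2 * (encodeGates f.prepare).length + 2)
      (tapes (st [false] [] (3 * W) (encodeGates (f.gapGates d) ++ [false]))) := by
    refine Run.to ((run_drain (by simp [only]) (by simp) (by simp [only]) _).mono ?_) ?_
    · simp [st]
    · have : encodeGates (f.gapGates d) = encodeGates f.prepare ++
          (encodeGates (phaseBlock (3 * W) d) ++ encodeGates f.prepare.reverse) := by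
        rw [BoolCircuit.gapGates, encodeGates_append, encodeGates_append, List.append_assoc]
      funext k
      simp only [st, only, decide_eq_true_eq, this]
      split_ifs <;> simp_all
  have r6 := run_pushToks_bwd (m := m) (g := g) (numToks 3).reverse [false] []
    (encodeGates (f.gapGates d) ++ [false]) (3 * W)
  rw [expand_reverse, expand_numToks, List.length_reverse, length_numToks] at r6
  obtain ⟨T, r7, hT⟩ := run_open (g := g) (st [false] [] (3 * W)
    (encodeNat (3 * W + 3) ++ (encodeGates (f.gapGates d) ++ [false]) : List Bool) :
      TIdx m → List Bool) (f.gapCircuit d).encode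
    (by rw [f.encode_gapCircuit, List.append_assoc]; simp [st, encodeGates]; rw [hWdef])
    (fun j => by simp [st, Fin.succ_ne_zero])
  refine ⟨T, ?_, hT⟩
  rw [hinit]
  refine (r1.seq (r2.seq ((run_skip_stOut false _ _ _ _ _).seq (r3.seq (r4.seq (r5.seq
    (r6.seq r7))))))).mono ?_
  -- There are at most `n + 6 * f.size ≤ 6 * W` gates. Each takes one marker and at most `3 * N + 2`
  -- bits, where `N = 3 * W + 3`.
  have hlen : (encodeGates f.prepare).length ≤ (6 * W) * (9 * W + 12) := by
    refine (length_flatMap_le _ _ (9 * W + 12) fun r hr => ?_).trans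
      (Nat.mul_le_mul_right _ ?_)
    · have := RGate.length_encode_le (f.prepare_valid r hr)
      rw [List.length_cons]
      omega
    · have := length_gateBlocks_le n f.gates
      rw [BoolCircuit.prepare, List.length_append, hadBlock, List.length_map, List.length_range']
      rw [BoolCircuit.size] at hWdef
      omega
  have h1 : n * (120 * W + 60) ≤ W * (120 * W + 60) := Nat.mul_le_mul_right _ (by omega)
  have h2 : f.gates.length * (3000 * W + 3000) ≤ W * (3000 * W + 3000) :=
    Nat.mul_le_mul_right _ (by rw [hWdef, BoolCircuit.size]; omega)
  have h3 : (8 * d + 15) * (4 * (3 * W) + 4) ≤ (15 * (d + 1)) * (12 * (W + 1)) :=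
    Nat.mul_le_mul (by omega) (by omega)
  nlinarith [Nat.zero_le (d * W), Nat.zero_le (d * W ^ 2), Nat.zero_le (W ^ 2)]

/-- A machine that behaves on (the description of) a Boolean circuit as `M` does on its gap
circuit, after polynomially many steps. -/
theorem exists_machine (M : Machine) (d : ℕ) : ∃ M' : Machine,
    ∀ (n : ℕ) (f : BoolCircuit n) (t : ℕ), M.HaltsWithin (f.gapCircuit d).encode t →
      M'.HaltsWithin f.encode (10000 * (d + 1) * (n + f.size + 1) ^ 2 + t) ∧
      (M'.NondetAccepts f.encode ↔ M.NondetAccepts (f.gapCircuit d).encode) := by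
  refine ⟨M.afterProg (r := 3) (prog d), fun n f t ht => ?_⟩
  obtain ⟨T, hT, hT'⟩ := run_prog (m := M.numTapes) (g := M.numSymbols) f d
  refine M.afterProg_spec (prog d) hT (fun j => ?_) ht
  rw [hT' j, Machine.init]
  dsimp only
  split_ifs <;> rfl

end Translate

/-! ### There are countably many machines -/

instance : Finite Turing.Dir :=
  Finite.of_injective (fun d => decide (d = Turing.Dir.left)) fun a b h => by
    cases a <;> cases b <;> simp_all

/-- With the three sizes fixed, the remaining data range over a finite type. -/
instance : Countable Machine := by
  have (k g s : ℕ) : Countable ((Fin s × (Fin s → Option Bool)) ×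
      (Bool → Fin s → (Fin (k + 1) → Symbol g) →
        Fin s × (Fin (k + 1) → Symbol g × Option Turing.Dir))) := by
    have h1 : Finite (Symbol g) := inferInstanceAs (Finite (Option (Bool ⊕ Fin g)))
    have h2 : Finite (Option Turing.Dir) := inferInstance
    have h3 : Finite (Fin s × (Fin (k + 1) → Symbol g × Option Turing.Dir)) := inferInstance
    have h4 : Finite (Fin s × (Fin s → Option Bool)) := inferInstance
    have h5 : Finite (Bool → Fin s → (Fin (k + 1) → Symbol g) →
        Fin s × (Fin (k + 1) → Symbol g × Option Turing.Dir)) := inferInstance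
    exact Finite.to_countable
  let F : Machine → Σ (k : ℕ) (g : ℕ) (s : ℕ), (Fin s × (Fin s → Option Bool)) ×
      (Bool → Fin s → (Fin (k + 1) → Symbol g) →
        Fin s × (Fin (k + 1) → Symbol g × Option Turing.Dir)) := fun M =>
    ⟨M.numTapes, M.numSymbols, M.numStates, (M.start, M.verdict), M.δ⟩
  refine Function.Injective.countable (f := F) ?_
  rintro ⟨k, g, s, a, v, d⟩ ⟨k', g', s', a', v', d'⟩ h
  simp only [F, Sigma.mk.injEq] at h
  obtain ⟨rfl, h⟩ := h
  rw [heq_eq_eq, Sigma.mk.injEq] at h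
  obtain ⟨rfl, h⟩ := h
  rw [heq_eq_eq, Sigma.mk.injEq] at h
  obtain ⟨rfl, h⟩ := h
  rw [heq_eq_eq, Prod.mk.injEq, Prod.mk.injEq] at h
  obtain ⟨⟨rfl, rfl⟩, rfl⟩ := h
  rfl

instance : Nonempty Machine :=
  ⟨{ numTapes := 0
     numSymbols := 0
     numStates := 1
     start := 0
     verdict := fun _ => none
     δ := fun _ s h => (s, fun k => (h k, none)) }⟩

/-! ### Growth -/

/-- A polynomial plus a multiple of a smaller exponential is eventually below an exponential. -/
theorem eventually_poly_add_exp_le (P : Polynomial ℕ) (K b c : ℝ) (hb : 0 ≤ b)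
    (hbc : b < c) : ∀ᶠ n : ℕ in Filter.atTop,
      ((P.eval n : ℕ) : ℝ) + K * (2 : ℝ) ^ (b * (n : ℝ)) ≤ (2 : ℝ) ^ (c * (n : ℝ)) := by
  have hl : 0 < Real.log 2 * (c - b) := mul_pos (Real.log_pos one_lt_two) (sub_pos.2 hbc)
  -- The argument is rescaled so that `exp` at `log 2 * (c - b) * n` is `2 ^ ((c - b) * n)` while
  -- `R` takes the value `P(n) + K` there.
  let R : Polynomial ℝ := (P.map (Nat.castRingHom ℝ) + Polynomial.C K).comp
    (Polynomial.C (Real.log 2 * (c - b))⁻¹ * Polynomial.X)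
  have h1 := R.tendsto_div_exp_atTop.comp
    ((tendsto_natCast_atTop_atTop (R := ℝ)).const_mul_atTop hl)
  filter_upwards [h1.eventually (gt_mem_nhds one_pos)] with n hn
  have hR : R.eval (Real.log 2 * (c - b) * n) = ((P.eval n : ℕ) : ℝ) + K := by
    simp only [R, Polynomial.eval_comp, Polynomial.eval_add, Polynomial.eval_mul,
      Polynomial.eval_C, Polynomial.eval_X, inv_mul_cancel_left₀ hl.ne', Polynomial.eval_natCast_map]
    simp
  simp only [Function.comp_apply, hR] at hn
  rw [div_lt_one (Real.exp_pos _), mul_assoc, ← Real.rpow_def_of_pos two_pos] at hn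
  have h2 : (1 : ℝ) ≤ (2 : ℝ) ^ (b * (n : ℝ)) :=
    Real.one_le_rpow one_le_two (by positivity)
  have h3 : (2 : ℝ) ^ (c * (n : ℝ)) = (2 : ℝ) ^ ((c - b) * (n : ℝ)) * (2 : ℝ) ^ (b * (n : ℝ)) := by
    rw [← Real.rpow_add two_pos]
    congr 1
    ring
  have h4 : (0 : ℝ) ≤ (P.eval n : ℕ) := Nat.cast_nonneg _
  rw [h3]
  nlinarith

/-! ### From samplers to the gap problem -/

/-- A circuit of `h` Hadamard gates on one qubit. -/
def hadamardCircuit (h : ℕ) : QCircuit where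
  numQubits := 1
  gates := List.replicate h (.H 0)

theorem numH_hadamardCircuit (h : ℕ) : (hadamardCircuit h).numH = h := by
  change List.countP QGate.isH (List.replicate h (QGate.H (0 : Fin 1))) = h
  simp [List.countP_replicate, QGate.isH]

theorem eval_mono (p : Polynomial ℕ) {a b : ℕ} (h : a ≤ b) : p.eval a ≤ p.eval b := by
  rw [Polynomial.eval_eq_sum, Polynomial.eval_eq_sum]
  exact Finset.sum_le_sum fun i _ => Nat.mul_le_mul_left _ (Nat.pow_le_pow_left h i)

/-- If all circuits for a hard gap problem are sampled by one machine, the gap problem is easy. -/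
theorem frequently_not_samples {a : ℝ} (ha : 0 < a) {p : Polynomial ℕ}
    (hp : ∀ (M : Machine) (T : ℕ → ℕ), M.DecidesGap p T →
      ∃ᶠ n : ℕ in Filter.atTop, (2 : ℝ) ^ ((1 - min a 1 / 2) * (n : ℝ)) < (T n : ℝ))
    (M : Machine) :
    ∃ᶠ h : ℕ in Filter.atTop, ∃ C : QCircuit, (C.numH = h ∧
      C.numQubits ≤ (3 * Polynomial.X + 12 * p + 3 : Polynomial ℕ).eval h ∧
      C.gates.length ≤ (3 * Polynomial.X + 12 * p + 3 : Polynomial ℕ).eval h) ∧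
      ∀ ε : ℝ, ε < 1 → ¬ M.Samples C ε ((2 : ℝ) ^ ((1 - a) * ((h : ℝ) / 2 - 1 / 2))) := by
  have hq (h : ℕ) : (3 * Polynomial.X + 12 * p + 3 : Polynomial ℕ).eval h =
      3 * h + 12 * p.eval h + 3 := by
    simp
  simp only [hq]
  intro hev
  -- From `d` Hadamards on, `M` samples every circuit within the size bounds. The same `d` is used
  -- for the padding, so that all `n`, small ones included, lie beyond the threshold.
  obtain ⟨d, hd⟩ := Filter.eventually_atTop.1 hev
  obtain ⟨M', hM'⟩ := Translate.exists_machine M d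
  -- Capping at one keeps `1 - α` nonnegative, as the growth estimate needs.
  set α := min a 1 with hα
  have hα0 : 0 < α := lt_min ha one_pos
  have hα1 : α ≤ 1 := min_le_right _ _
  have hαa : α ≤ a := min_le_left _ _
  let τ : ℕ → ℝ := fun n => (2 : ℝ) ^ ((1 - a) * (((2 * n + 2 + 2 * d : ℕ) : ℝ) / 2 - 1 / 2))
  let P : Polynomial ℕ := 10000 * Polynomial.C (d + 1) * (Polynomial.X + p + 1) ^ 2
  have hP (n : ℕ) : P.eval n = 10000 * (d + 1) * (n + p.eval n + 1) ^ 2 := by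
    simp [P]
  have hdec : M'.DecidesGap p fun n => P.eval n + ⌊τ n⌋₊ := by
    intro n f hf
    have hneg := hd (2 * n + 2 + 2 * d) (by omega)
    push Not at hneg
    have hmono : p.eval n ≤ p.eval (2 * n + 2 + 2 * d) := eval_mono p (by omega)
    obtain ⟨ε, hε, hs⟩ := hneg (f.gapCircuit d) ⟨f.numH_gapCircuit d,
      by rw [f.numQubits_gapCircuit]; omega, by have := f.length_gapCircuit_le d; omega⟩
    obtain ⟨t, ht, hh, hacc⟩ := hs.nondetAccepts_iff hε
    obtain ⟨h1, h2⟩ := hM' n f t hh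
    refine ⟨h1.mono (Nat.add_le_add ?_ (Nat.le_floor ht)), ?_⟩
    · rw [hP]
      exact Nat.mul_le_mul_left _ (Nat.pow_le_pow_left (by omega) 2)
    · rw [h2, hacc, Ne, f.acceptProb_gapCircuit_eq_zero_iff]
  refine hp M' _ hdec ?_
  -- With `h = 2n + 2 + 2d` the sampling exponent is `(1 - a) * (n + d + 1/2)`. Its part independent
  -- of `n` becomes the constant factor, and the gap between `1 - α` and `1 - α / 2` absorbs the
  -- rest.
  filter_upwards [eventually_poly_add_exp_le P ((2 : ℝ) ^ ((1 - α) * (d + 1 / 2 : ℝ))) (1 - α)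
    (1 - α / 2) (by linarith) (by linarith)] with n hn
  rw [not_lt]
  refine le_trans ?_ hn
  rw [Nat.cast_add]
  refine add_le_add le_rfl ?_
  refine (Nat.floor_le (by positivity)).trans ?_
  rw [← Real.rpow_add two_pos]
  refine Real.rpow_le_rpow_of_exponent_le one_le_two ?_
  push_cast
  have : (0 : ℝ) ≤ n + d + 1 / 2 := by positivity
  nlinarith

end FineGrained

/-! ### Diagonalization over all machines -/

open FineGrained in
theorem theorem9 (conjecture : GapConjecture) (a : ℝ) (ha : 0 < a) :
    ∃ (q : Polynomial ℕ) (C : ℕ → QCircuit),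
      (∀ h : ℕ, (C h).numH = h ∧ (C h).numQubits ≤ q.eval h ∧
        (C h).gates.length ≤ q.eval h) ∧
      ∀ M : Machine, ∃ᶠ h : ℕ in Filter.atTop,
        ∀ ε : ℝ, ε < 1 →
          ¬ M.Samples (C h) ε ((2 : ℝ) ^ ((1 - a) * ((h : ℝ) / 2 - 1 / 2))) := by
  classical
  obtain ⟨p, hp⟩ := conjecture (min a 1 / 2) (half_pos (lt_min ha one_pos))
  obtain ⟨e, he⟩ := exists_surjective_nat Machine
  -- The `k`-th bad circuit is directed against machine number `k.unpair.1`, so every machine is met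
  -- infinitely often; strict monotonicity of `φ` keeps the values of `h` distinct.
  obtain ⟨φ, hφ, hC⟩ := Filter.extraction_forall_of_frequently
    fun k : ℕ => frequently_not_samples ha hp (e k.unpair.1)
  choose D hD hDs using hC
  -- Values of `h` outside the range of `φ` get a filler circuit with the right Hadamard count.
  let C : ℕ → QCircuit := fun h => if H : ∃ k, φ k = h then D H.choose else hadamardCircuit h
  have hCφ (k : ℕ) : C (φ k) = D k := by
    have H : ∃ j, φ j = φ k := ⟨k, rfl⟩
    have : H.choose = k := hφ.injective H.choose_spec
    simp only [C, dif_pos H, this]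
  refine ⟨3 * Polynomial.X + 12 * p + 3, C, fun h => ?_, fun M => ?_⟩
  · by_cases H : ∃ k, φ k = h
    · obtain ⟨k, rfl⟩ := H
      rw [hCφ]
      exact hD k
    · rw [show C h = hadamardCircuit h from dif_neg H]
      refine ⟨numH_hadamardCircuit h, ?_, ?_⟩
      · simp [hadamardCircuit]
      · simp [hadamardCircuit]
        omega
  · obtain ⟨j, rfl⟩ := he M
    rw [Filter.frequently_atTop]
    intro b
    -- Pairing `j` with `b` selects an index for machine `j` that is at least `b`.
    refine ⟨φ (Nat.pair j b), (Nat.right_le_pair j b).trans (hφ.id_le _), ?_⟩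
    have := hDs (Nat.pair j b)
    rw [Nat.unpair_pair] at this
    rw [hCφ]
    exact this
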